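/- Let $(X,d)$ be an unbounded metric space with a Borel measure $\mu$. Write $V(x,t)=\mu(B(x,t))$, where $B(x,t)$ is the open ball, and suppose that $X$ is AD-regular: for some $n>0$ and $C\ge 1$, $C^{-1}r^n\le V(x,r)\le Cr^n$ for all $x\in X$ and $0<r<\operatorname{diam}(X)=\infty$. Let $X^+=X\times(0,\infty)$ carry the measure $d\mu(y)\,dt/t$. For measurable $f$ on $X^+$ (modulo null sets) and $p,q\in(1,\infty)$, $s\in\mathbb{R}$, $c_0\in(0,\infty)$, $c_1\in(1,\infty)$ put $$\|f\|_{T^{p,q}_s}=\left(\int_X\left(\int_0^\infty\!\!\int_{B(x,t)}|V(y,t)^{-s}f(y,t)|^q\,\frac{d\mu(y)}{V(y,t)}\frac{dt}{t}\right)^{p/q}d\mu(x)\right)^{1/p},$$ $$\|f\|_{Z^{p,q}_s(X;c_0,c_1)}=\left(\int_0^\infty\!\!\int_X\left(\frac{1}{|\Omega(x,t)|}\iint_{\Omega(x,t)}|V(\xi,\tau)^{-s}f(\xi,\tau)|^q\,d\mu(\xi)\,d\tau\right)^{p/q}d\mu(x)\,\frac{dt}{t}\right)^{1/p},$$ where $\Omega(x,t)=B(x,c_0t)\times(c_1^{-1}t,c_1t)$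 and $|\Omega(x,t)|$ is its measure with respect to $d\mu\,d\tau$. The weighted tent space $T^{p,q}_s$ and the space $Z^{p,q}_s(X;c_0,c_1)$ consist of the $f$ for which the respective norm is finite. $(\cdot,\cdot)_{\theta,p}$ denotes the real interpolation space given by the $K$-method. **Theorem.** Let $p_0,p_1,q\in(1,\infty)$, $s_0\ne s_1$ in $\mathbb{R}$, $\theta\in(0,1)$, and let $p_\theta^{-1}=(1-\theta)p_0^{-1}+\theta p_1^{-1}$ and $s_\theta=(1-\theta)s_0+\theta s_1$. Then for any $c_0\in(0,\infty)$ and $c_1\in(1,\infty)$, $$(T^{p_0,q}_{s_0},T^{p_1,q}_{s_1})_{\theta,p_\theta}=Z^{p_\theta,q}_{s_\theta}(X;c_0,c_1)$$ with equivalent norms. Consequently, for all $p,q\in(1,\infty)$ and $s\in\mathbb{R}$, the spaces $Z^{p,q}_s(X;c_0,c_1)$, $c_0\in(0,\infty)$, $c_1\in(1,\infty)$, are all equal, with equivalent norms. -/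

import Mathlib

open MeasureTheory Set
open scoped ENNReal NNReal

noncomputable section

namespace WeightedTent

section Spaces

variable {X : Type*} [MetricSpace X] [MeasurableSpace X]

/-- AD-regularity of dimension `n`: there is `C ≥ 1` such that
`C⁻¹ r ^ n ≤ μ (B(x,r)) ≤ C r ^ n` for all `x` and all radii `0 < r < diam X`
(the diameter may be infinite). -/
def IsADRegularOfDim (μ : Measure X) (n : ℝ) : Prop :=
  ∃ C : ℝ, 1 ≤ C ∧ ∀ (x : X) (r : ℝ), 0 < r →
    ENNReal.ofReal r < Metric.ediam (univ : Set X) →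
      ENNReal.ofReal (C⁻¹ * r ^ n) ≤ μ (Metric.ball x r) ∧
        μ (Metric.ball x r) ≤ ENNReal.ofReal (C * r ^ n)

/-- AD-regularity of some dimension `n > 0`. -/
def IsADRegular (μ : Measure X) : Prop :=
  ∃ n : ℝ, 0 < n ∧ IsADRegularOfDim μ n

/-- The measure `dt / t` on `(0, ∞)`, seen as a measure on `ℝ` that vanishes on `(-∞, 0]`. -/
def haarPos : Measure ℝ :=
  (volume.restrict (Ioi (0 : ℝ))).withDensity fun t => ENNReal.ofReal t⁻¹

/-- The measure `dμ(y) dt / t` of the half-space `X⁺ = X × (0, ∞)`, seen as a measure on `X × ℝ`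
that vanishes on `X × (-∞, 0]`. -/
def halfSpaceMeasure (μ : Measure X) : Measure (X × ℝ) :=
  μ.prod haarPos

/-- `L⁰(X⁺)`: complex measurable functions on `X⁺`, modulo equality almost everywhere. -/
abbrev L0 (μ : Measure X) : Type _ :=
  (X × ℝ) →ₘ[halfSpaceMeasure μ] ℂ

/-- The operator `(V^s f)(x,t) = V(x,t)^s f(x,t)`, where `V(x,t) = μ (B(x,t))`. -/
def volOp (μ : Measure X) (s : ℝ) (f : X × ℝ → ℂ) : X × ℝ → ℂ :=
  fun z => ((μ.real (Metric.ball z.1 z.2) ^ s : ℝ) : ℂ) * f z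

/-- The cone `Γ(x)` of all `(y,t)` with `d(x,y) < t` (so that `t > 0`). -/
def cone (x : X) : Set (X × ℝ) :=
  {z | z.1 ∈ Metric.ball x z.2}

/-- The Lusin function
`A^q f (x) = (∬_{Γ(x)} |f(y,t)|^q dμ(y)/V(y,t) dt/t)^{1/q}`. -/
def lusin (μ : Measure X) (q : ℝ) (f : X × ℝ → ℂ) (x : X) : ℝ≥0∞ :=
  (∫⁻ z in cone x, ‖f z‖ₑ ^ q / μ (Metric.ball z.1 z.2) ∂(halfSpaceMeasure μ)) ^ (1 / q)

/-- The quasi-norm of the weighted tent space `T^{p,q}_s`, for finite `p` and `q`; it is `∞` at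
the functions outside the space. -/
def tentNorm (μ : Measure X) (p q s : ℝ) (f : L0 μ) : ℝ≥0∞ :=
  (∫⁻ x, lusin μ q (volOp μ (-s) f) x ^ p ∂μ) ^ (1 / p)

/-- The Whitney region `Ω_{c₀,c₁}(x,t) = B(x, c₀ t) × (c₁⁻¹ t, c₁ t)`. -/
def whitneyRegion (c₀ c₁ : ℝ) (z : X × ℝ) : Set (X × ℝ) :=
  Metric.ball z.1 (c₀ * z.2) ×ˢ Ioo (c₁⁻¹ * z.2) (c₁ * z.2)

/-- The `L^q`-Whitney average; the mean over the Whitney region is with respect to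
`dμ(ξ) dτ`. -/
def whitneyAverage (μ : Measure X) (q c₀ c₁ : ℝ) (f : X × ℝ → ℂ) (z : X × ℝ) : ℝ≥0∞ :=
  (⨍⁻ w in whitneyRegion c₀ c₁ z, ‖f w‖ₑ ^ q ∂(μ.prod (volume : Measure ℝ))) ^ (1 / q)

/-- The quasi-norm of `Z^{p,q}_s(X; c₀, c₁)`; it is `∞` at the functions outside the space. -/
def zNorm (μ : Measure X) (p q s c₀ c₁ : ℝ) (f : L0 μ) : ℝ≥0∞ :=
  (∫⁻ z, whitneyAverage μ q c₀ c₁ (volOp μ (-s) f) z ^ p ∂(halfSpaceMeasure μ)) ^ (1 / p)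

/-- The space `Z^{p,q}_s(X; c₀, c₁)`. -/
def ZSpace (μ : Measure X) (p q s c₀ c₁ : ℝ) : Set (L0 μ) :=
  {f | zNorm μ p q s c₀ c₁ f < ∞}

end Spaces

section Interpolation

variable {A : Type*} [AddCommGroup A]

/-- The `K`-functional of the couple of the subspaces `A₀ = {N₀ < ∞}` and `A₁ = {N₁ < ∞}` of `A`:
the infimum of `‖a₀‖ + t ‖a₁‖` over the decompositions `a = a₀ + a₁`.
A decomposition with `a₀ ∉ A₀` or `a₁ ∉ A₁` contributes `∞`, so `K` is `∞` off `A₀ + A₁`. -/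
def kFunctional (N₀ N₁ : A → ℝ≥0∞) (t : ℝ) (a : A) : ℝ≥0∞ :=
  ⨅ (a₀ : A) (a₁ : A) (_ : a₀ + a₁ = a), N₀ a₀ + ENNReal.ofReal t * N₁ a₁

/-- The norm of the real interpolation space `(A₀, A₁)_{θ,p}`, for `p < ∞`:
`(∫_0^∞ (t^{-θ} K(t,a))^p dt/t)^{1/p}`. -/
def realInterpNorm (N₀ N₁ : A → ℝ≥0∞) (θ p : ℝ) (a : A) : ℝ≥0∞ :=
  (∫⁻ t, (ENNReal.ofReal (t ^ (-θ)) * kFunctional N₀ N₁ t a) ^ p ∂haarPos) ^ (1 / p)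

/-- The real interpolation space `(A₀, A₁)_{θ,p}`. -/
def RealInterpSpace (N₀ N₁ : A → ℝ≥0∞) (θ p : ℝ) : Set A :=
  {a | realInterpNorm N₀ N₁ θ p a < ∞}

/-- Two norms (with value `∞` allowed) are equivalent on the set `S`. -/
def EquivNormsOn (S : Set A) (N M : A → ℝ≥0∞) : Prop :=
  ∃ C : ℝ≥0, ∀ a ∈ S, N a ≤ C * M a ∧ M a ≤ C * N a

end Interpolation

end WeightedTent

end

open Filter Topology

/-! Cover the half-space by boxes, balls of radius about e^{lk} times layers (e^{lk}, e^{l(k+1)}],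
with boundedly many boxes near any point at each scale. Let β_i be the normalised L^q norm of f on
box i, of scale k_i. By AD-regularity V is about e^{nlk_i} on that box, so the weight V^{-s} acts
there as the scalar e^{-snlk_i}. The Z-norm becomes a weighted ℓ^p norm: its p-th power is
comparable to ∑ e^{nlk_i} (e^{-snlk_i} β_i)^p. The Lusin function at x is not an ℓ^p expression in
the β_i, but it lies between the supremum and the sum of e^{-snlk_i} β_i over boxes near x
(`le_lusin`, `lusin_le`).

The K-functional mixes norms with different outer exponents. Following the power theorem of real
interpolation, it is traded for the L-functional inf ‖f₀‖^{p₀} + e^m ‖f₁‖^{p₁}, summed against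
e^{-ηm}, where p₀(1-η) = (1-θ)p and p₁η = θp (`realInterpNorm_rpow_le_of_decomp`,
`tsum_lFunctional_le`). Powers of tent norms are integrals over X, so the problem can be solved at
each x separately.

At fixed x put a_i = e^{-s₀nlk_i} β_i and b_i = e^{-s₁nlk_i} β_i. Because s₀ ≠ s₁, the ratio a_i/b_i
is geometric in k_i. Hence, where a_i^{p₀} ≤ e^τ b_i^{p₁}, the sum of the a_i is controlled by a
supremum (`tsum_rpow_le_iSup`), which closes the gap between the two bounds for the Lusin function.
Splitting f according to whether a_i^{p₀} ≤ e^m b_i^{p₁} bounds the interpolation norm from above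
(`tsum_split_le`); conversely every decomposition dominates min(a_i^{p₀}, e^m b_i^{p₁})
(`tsum_le_tsum_iSup_min`). Both estimates produce a_i^{p₀(1-η)} b_i^{p₁η} = (e^{-s_θ nlk_i} β_i)^p,
and integration in x supplies the factor e^{nlk_i}: this is the discrete Z-norm. The interpolation
space does not involve c₀ and c₁, so neither does the Z-space. -/

namespace WeightedTent

/-! ### Geometric series and discrete interpolation estimates -/

/-- The exponential of a real number, as an extended nonnegative real. -/
noncomputable def eexp (x : ℝ) : ℝ≥0∞ := ENNReal.ofReal (Real.exp x)

theorem eexp_add (x y : ℝ) : eexp (x + y) = eexp x * eexp y := by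
  rw [eexp, Real.exp_add, ENNReal.ofReal_mul (Real.exp_pos _).le]; rfl

@[simp] theorem eexp_zero : eexp 0 = 1 := by simp [eexp]

@[simp] theorem eexp_ne_zero (x : ℝ) : eexp x ≠ 0 := by simp [eexp, Real.exp_pos]

@[simp] theorem eexp_ne_top (x : ℝ) : eexp x ≠ ∞ := ENNReal.ofReal_ne_top

@[simp] theorem eexp_le_eexp {x y : ℝ} : eexp x ≤ eexp y ↔ x ≤ y := by
  rw [eexp, eexp, ENNReal.ofReal_le_ofReal_iff (Real.exp_pos _).le, Real.exp_le_exp]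

theorem eexp_rpow (x p : ℝ) : eexp x ^ p = eexp (x * p) := by
  rw [eexp, ENNReal.ofReal_rpow_of_pos (Real.exp_pos _), ← Real.exp_mul]; rfl

theorem eexp_neg_mul_cancel (x : ℝ) : eexp (-x) * eexp x = 1 := by
  rw [← eexp_add]; simp

theorem eexp_mul_neg_cancel (x : ℝ) : eexp x * eexp (-x) = 1 := by
  rw [← eexp_add]; simp

theorem eexp_min (x y : ℝ) : eexp (min x y) = min (eexp x) (eexp y) := by
  rcases le_total x y with h | h
  · rw [min_eq_left h, min_eq_left (eexp_le_eexp.2 h)]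
  · rw [min_eq_right h, min_eq_right (eexp_le_eexp.2 h)]

theorem exists_eq_eexp {a : ℝ≥0∞} (h0 : a ≠ 0) (ht : a ≠ ∞) : ∃ x, a = eexp x := by
  refine ⟨Real.log a.toReal, ?_⟩
  rw [eexp, Real.exp_log (ENNReal.toReal_pos h0 ht), ENNReal.ofReal_toReal ht]

/-- A two-sided geometric series whose centre is arbitrary. -/
theorem tsum_eexp_neg_abs_le {δ c : ℝ} (hδ : 0 < δ) (hc : c ≠ 0) :
    ∃ C : ℝ≥0∞, C ≠ ∞ ∧ ∀ y : ℝ, ∑' k : ℤ, eexp (-(δ * |y + c * k|)) ≤ C := by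
  set d := δ * |c| with hd
  have hd0 : 0 < d := mul_pos hδ (abs_pos.2 hc)
  have hgeo : Summable fun n : ℕ => Real.exp (-(d * n)) := by
    have := summable_geometric_of_lt_one (Real.exp_pos (-d)).le (by simpa using hd0)
    refine this.congr fun n => ?_
    rw [← Real.exp_nat_mul]; ring_nf
  have hs : Summable fun k : ℤ => Real.exp (-(d * |(k : ℝ)|)) :=
    Summable.of_nat_of_neg (by simpa using hgeo) (by simpa using hgeo)
  refine ⟨eexp d * ∑' k : ℤ, eexp (-(d * |(k : ℝ)|)),
    ENNReal.mul_ne_top (eexp_ne_top _) hs.tsum_ofReal_ne_top, fun y => ?_⟩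
  -- Shifting the index by `⌊y / c⌋` brings the centre within one step of 0; the factor e^d pays for
  -- that step.
  rw [← ENNReal.tsum_mul_left,
    ← (Equiv.addLeft ⌊y / c⌋).tsum_eq fun k : ℤ => eexp d * eexp (-(d * |(k : ℝ)|))]
  refine ENNReal.tsum_le_tsum fun k => ?_
  rw [← eexp_add, eexp_le_eexp]
  have h1 : y + c * k = c * (y / c + k) := by field_simp
  have h2 : |(⌊y / c⌋ : ℝ) + k| ≤ |y / c + k| + 1 := by
    have h3 := Int.floor_le (y / c)
    have h4 := Int.lt_floor_add_one (y / c)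
    have : |(⌊y / c⌋ : ℝ) + k - (y / c + k)| ≤ 1 := by rw [abs_le]; constructor <;> linarith
    have := abs_sub_abs_le_abs_sub ((⌊y / c⌋ : ℝ) + k) (y / c + k)
    linarith
  rw [h1, abs_mul, ← mul_assoc, ← hd]
  simp only [Equiv.coe_addLeft, Int.cast_add]
  nlinarith

/-- `∑ₗ (e^{-θ l} min(e^l e, d))^p ≲ d^{(1-θ)p} e^{θp}`. -/
theorem tsum_min_rpow_le {θ p : ℝ} (h0 : 0 < θ) (h1 : θ < 1) (hp : 0 < p) :
    ∃ C : ℝ≥0∞, C ≠ ∞ ∧ ∀ d e : ℝ≥0∞,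
      ∑' l : ℤ, (eexp (-θ * l) * min (eexp l * e) d) ^ p
        ≤ C * (d ^ ((1 - θ) * p) * e ^ (θ * p)) := by
  have hδ : 0 < p * min θ (1 - θ) := mul_pos hp (lt_min h0 (by linarith))
  obtain ⟨C, hC, hgeo⟩ := tsum_eexp_neg_abs_le hδ one_ne_zero
  have hp1 : 0 < (1 - θ) * p := mul_pos (by linarith) hp
  have hp2 : 0 < θ * p := mul_pos h0 hp
  -- The `+ 1` keeps the constant nonzero, so that the right side is `∞` when one of `d`, `e` is
  -- infinite and neither vanishes.
  refine ⟨C + 1, by simp [hC], fun d e => ?_⟩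
  rcases eq_or_ne d 0 with rfl | hd0
  · simp [hp]
  rcases eq_or_ne e 0 with rfl | he0
  · simp [hp]
  rcases eq_or_ne d ∞ with rfl | hdt
  · rw [ENNReal.top_rpow_of_pos hp1, ENNReal.top_mul, ENNReal.mul_top (by simp)]
    · exact le_top
    · simp [ENNReal.rpow_eq_zero_iff, he0, hp2.not_gt]
  rcases eq_or_ne e ∞ with rfl | het
  · rw [ENNReal.top_rpow_of_pos hp2, ENNReal.mul_top, ENNReal.mul_top (by simp)]
    · exact le_top
    · simp [ENNReal.rpow_eq_zero_iff, hd0, hp1.not_gt]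
  obtain ⟨x, rfl⟩ := exists_eq_eexp hd0 hdt
  obtain ⟨y, rfl⟩ := exists_eq_eexp he0 het
  calc _ ≤ ∑' l : ℤ, eexp (-(p * min θ (1 - θ) * |y - x + 1 * l|)) *
          (eexp x ^ ((1 - θ) * p) * eexp y ^ (θ * p)) := by
        refine ENNReal.tsum_le_tsum fun l => ?_
        simp only [← eexp_add, ← eexp_min, eexp_rpow, eexp_le_eexp]
        -- The two entries of the minimum cross at l = x - y; the terms decay at rate 1 - θ to the
        -- left and θ to the right.
        have key : -θ * l + min (l + y) x ≤
            -(min θ (1 - θ) * |y - x + 1 * l|) + x * (1 - θ) + y * θ := by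
          rcases le_total (l + y) x with h | h
          · rw [min_eq_left h, abs_of_nonpos (by linarith)]
            nlinarith [min_le_right θ (1 - θ)]
          · rw [min_eq_right h, abs_of_nonneg (by linarith)]
            nlinarith [min_le_left θ (1 - θ)]
        calc _ ≤ (-(min θ (1 - θ) * |y - x + 1 * l|) + x * (1 - θ) + y * θ) * p :=
              mul_le_mul_of_nonneg_right key hp.le
          _ = _ := by ring
    _ ≤ _ := by
        rw [ENNReal.tsum_mul_right]
        gcongr
        exact (hgeo _).trans le_self_add

/-- Discrete interpolation estimate: if `H l ≤ d m + e^l e m` for all `m`, then the `θ, p`-norm of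
`H` is controlled by the products of consecutive terms. -/
theorem tsum_interpolation_le {θ p : ℝ} (h0 : 0 < θ) (h1 : θ < 1) (hp : 0 < p) :
    ∃ C : ℝ≥0∞, C ≠ ∞ ∧ ∀ d e H : ℤ → ℝ≥0∞, (∀ l m : ℤ, H l ≤ d m + eexp l * e m) →
      Tendsto d atBot (𝓝 0) → Tendsto e atTop (𝓝 0) →
      ∑' l : ℤ, (eexp (-θ * l) * H l) ^ p
        ≤ C * ∑' m : ℤ, d (m + 1) ^ ((1 - θ) * p) * e m ^ (θ * p) := by
  obtain ⟨C, hC, hmin⟩ := tsum_min_rpow_le h0 h1 hp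
  refine ⟨2 ^ p * C, ENNReal.mul_ne_top (by simp) hC, fun d e H hH hd he => ?_⟩
  have key (l : ℤ) : (eexp (-θ * l) * H l) ^ p ≤
      ∑' m : ℤ, 2 ^ p * (eexp (-θ * l) * min (eexp l * e m) (d (m + 1))) ^ p := by
    rcases eq_or_ne (H l) 0 with h | h
    · simp [h, hp]
    -- A crossing of `d` and e^l `e`. Without one, either e^l `e` dominates from some index on, or
    -- `d` dominates everywhere; the limit at +∞, respectively -∞, then forces `H l = 0`. At a
    -- crossing, the indices m and m + 1 bound `H l` by twice each entry of the minimum.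
    obtain ⟨m, hm, hm'⟩ : ∃ m : ℤ, d m ≤ eexp l * e m ∧ ¬ d (m + 1) ≤ eexp l * e (m + 1) := by
      by_contra! hcon
      rcases em (∃ a, d a ≤ eexp l * e a) with ⟨a, ha⟩ | hno
      · have hall : ∀ b ≥ a, d b ≤ eexp l * e b := fun b hb =>
          Int.leInduction ha (fun n _ hn => hcon n hn) b hb
        have ht : Tendsto (fun m => eexp l * e m + eexp l * e m) atTop (𝓝 0) := by
          have := ENNReal.Tendsto.const_mul he (Or.inr (eexp_ne_top l))
          simpa using this.add this
        refine h (le_antisymm (ge_of_tendsto ht ?_) zero_le)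
        filter_upwards [eventually_ge_atTop a] with m hm
        exact (hH l m).trans (by gcongr; exact hall m hm)
      · push Not at hno
        have ht : Tendsto (fun m => d m + d m) atBot (𝓝 0) := by simpa using hd.add hd
        refine h (le_antisymm (ge_of_tendsto ht ?_) zero_le)
        exact Eventually.of_forall fun m => (hH l m).trans (by gcongr; exact (hno m).le)
    refine le_trans ?_ (ENNReal.le_tsum m)
    rw [← ENNReal.mul_rpow_of_nonneg _ _ hp.le]
    refine ENNReal.rpow_le_rpow ?_ hp.le
    rw [mul_left_comm]
    gcongr
    push Not at hm'
    rw [mul_min_of_nonneg _ _ zero_le, two_mul, two_mul]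
    refine le_min ((hH l m).trans (by gcongr)) ((hH l (m + 1)).trans (by gcongr))
  calc _ ≤ ∑' (l : ℤ) (m : ℤ), 2 ^ p * (eexp (-θ * l) * min (eexp l * e m) (d (m + 1))) ^ p :=
        ENNReal.tsum_le_tsum key
    _ = ∑' m : ℤ, 2 ^ p * ∑' l : ℤ, (eexp (-θ * l) * min (eexp l * e m) (d (m + 1))) ^ p := by
        rw [ENNReal.tsum_comm]; simp only [ENNReal.tsum_mul_left]
    _ ≤ ∑' m : ℤ, 2 ^ p * (C * (d (m + 1) ^ ((1 - θ) * p) * e m ^ (θ * p))) := by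
        gcongr; exact hmin _ _
    _ = _ := by simp only [ENNReal.tsum_mul_left, mul_assoc]

/-- A sum over a family with at most `N` members at each level is bounded by the sum over
the levels. -/
theorem tsum_indicator_level_le {ι : Type*} {k : ι → ℤ} {I : Set ι} {N : ℝ≥0∞}
    (hI : ∀ j, ∑' i, (I ∩ k ⁻¹' {j}).indicator 1 i ≤ N) {f : ι → ℝ≥0∞} {h : ℤ → ℝ≥0∞}
    (hf : ∀ i ∈ I, f i ≤ h (k i)) :
    ∑' i, I.indicator f i ≤ N * ∑' j, h j := by
  calc ∑' i, I.indicator f i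
      ≤ ∑' i, ∑' j, h j * (I ∩ k ⁻¹' {j}).indicator 1 i := by
        refine ENNReal.tsum_le_tsum fun i => ?_
        by_cases hi : i ∈ I
        · refine le_trans ?_ (ENNReal.le_tsum (k i))
          simp [hi, hf i hi]
        · simp [hi]
    _ = ∑' j, h j * ∑' i, (I ∩ k ⁻¹' {j}).indicator 1 i := by
        rw [ENNReal.tsum_comm]; simp only [ENNReal.tsum_mul_left]
    _ ≤ ∑' j, h j * N := by gcongr; exact hI _
    _ = _ := by rw [ENNReal.tsum_mul_right, mul_comm]

theorem level_mono {ι : Type*} {k : ι → ℤ} {I J : Set ι} {N : ℝ≥0∞} (hIJ : I ⊆ J)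
    (hJ : ∀ j, ∑' i, (J ∩ k ⁻¹' {j}).indicator 1 i ≤ N) (j : ℤ) :
    ∑' i, (I ∩ k ⁻¹' {j}).indicator (1 : ι → ℝ≥0∞) i ≤ N := by
  refine le_trans (ENNReal.tsum_le_tsum fun i => ?_) (hJ j)
  exact indicator_le_indicator_of_subset (inter_subset_inter_left _ hIJ) (fun _ => zero_le) i

theorem tsum_rpow_le_rpow_tsum {ι : Type*} {p : ℝ} (hp : 1 ≤ p) (f : ι → ℝ≥0∞) :
    ∑' i, f i ^ p ≤ (∑' i, f i) ^ p := by
  have hsplit (x : ℝ≥0∞) : x ^ p = x * x ^ (p - 1) := by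
    have := ENNReal.rpow_add_of_nonneg (x := x) 1 (p - 1) zero_le_one (by linarith)
    rwa [ENNReal.rpow_one, add_sub_cancel] at this
  calc ∑' i, f i ^ p ≤ ∑' i, f i * (∑' j, f j) ^ (p - 1) := by
        refine ENNReal.tsum_le_tsum fun i => ?_
        rw [hsplit]
        gcongr
        exact ENNReal.le_tsum i
    _ = _ := by rw [ENNReal.tsum_mul_right, ← hsplit]

/-! ### Sums against suprema for sequences with geometric ratios -/

section Sequences

variable {ι : Type*} {k : ι → ℤ} {p₀ p₁ c₀ c₁ η : ℝ} {N : ℝ≥0∞}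

/-- Let `aᵢ = e^{c₀ kᵢ} βᵢ` and `bᵢ = e^{c₁ kᵢ} βᵢ` with `c₀ ≠ c₁`. On a family where
`aᵢ^{p₀} ≤ e^τ bᵢ^{p₁}` the sum of the `aᵢ` is controlled by a supremum. -/
theorem tsum_rpow_le_iSup (k : ι → ℤ) (hp₀ : 0 < p₀) (hp₁ : 0 < p₁) (hc : c₀ ≠ c₁)
    (hη0 : 0 < η) (hη1 : η < 1) (hN : N ≠ ∞) :
    ∃ C : ℝ≥0∞, C ≠ ∞ ∧ ∀ (β : ι → ℝ≥0∞) (I : Set ι) (τ : ℝ), (∀ i, β i ≠ ∞) →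
      (∀ j, ∑' i, (I ∩ k ⁻¹' {j}).indicator 1 i ≤ N) →
      (∀ i ∈ I, (eexp (c₀ * k i) * β i) ^ p₀ ≤ eexp τ * (eexp (c₁ * k i) * β i) ^ p₁) →
      (∑' i, I.indicator (fun i => eexp (c₀ * k i) * β i) i) ^ p₀ ≤
        C * ⨆ i ∈ I, ((eexp (c₀ * k i) * β i) ^ p₀) ^ (1 - η) *
          (eexp τ * (eexp (c₁ * k i) * β i) ^ p₁) ^ η := by
  have he : 0 < p₀ * (1 - η) + η * p₁ := by
    have : 0 < p₀ * (1 - η) := mul_pos hp₀ (by linarith)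
    positivity
  set e := p₀ * (1 - η) + η * p₁ with he_def
  -- The decay rate is the smaller of the slopes obtained from the two linear constraints below, one
  -- for each sign of `W`.
  set δ := min (η / e) (1 / (p₀ + p₁)) with hδ_def
  have hδ : 0 < δ := lt_min (by positivity) (by positivity)
  have hcc : -(p₁ * (c₁ - c₀)) ≠ 0 :=
    neg_ne_zero.2 (mul_ne_zero hp₁.ne' (sub_ne_zero.2 hc.symm))
  obtain ⟨G, hG, hgeo⟩ := tsum_eexp_neg_abs_le hδ hcc
  refine ⟨(N * G) ^ p₀, ENNReal.rpow_ne_top_of_nonneg hp₀.le (ENNReal.mul_ne_top hN hG),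
    fun β I τ hβ hI hA => ?_⟩
  set S := ⨆ i ∈ I, ((eexp (c₀ * k i) * β i) ^ p₀) ^ (1 - η) *
          (eexp τ * (eexp (c₁ * k i) * β i) ^ p₁) ^ η with hS
  have hle : ∀ i ∈ I, ((eexp (c₀ * k i) * β i) ^ p₀) ^ (1 - η) *
          (eexp τ * (eexp (c₁ * k i) * β i) ^ p₁) ^ η ≤ S := fun i hi =>
    le_iSup₂_of_le i hi le_rfl
  have hη2 : 0 < 1 - η := by linarith
  rcases eq_or_ne S 0 with h0 | h0
  · have : ∀ i, I.indicator (fun i => eexp (c₀ * k i) * β i) i = 0 := by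
      intro i
      by_cases hi : i ∈ I
      · have := hle i hi
        rw [h0, nonpos_iff_eq_zero] at this
        have hb : β i = 0 := by
          by_contra hb
          simp [ENNReal.rpow_eq_zero_iff, hb, hη2, hη0, hp₀, hp₁, hp₀.not_gt, hp₁.not_gt,
            ENNReal.mul_eq_top, hβ i, hη2.not_gt, hη0.not_gt] at this
        simp [hi, hb]
      · simp [hi]
    simp [this, hp₀]
  rcases eq_or_ne S ∞ with ht | ht
  · rw [ht]
    -- `G` bounds a positive series, so a vanishing constant means `N = 0`; the family is then empty
    -- and the left side is 0.
    rcases eq_or_ne ((N * G) ^ p₀) 0 with hz | hz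
    · have hNG : N * G = 0 := by
        rcases ENNReal.rpow_eq_zero_iff.1 hz with h | h
        · exact h.1
        · exact absurd h.2 hp₀.not_gt
      have hG0 : G ≠ 0 := by
        intro hG0
        have := (ENNReal.le_tsum 0).trans (hgeo 0)
        simp [hG0] at this
      have hN0 : N = 0 := by simpa [hG0] using hNG
      have hsum := tsum_indicator_level_le (N := N) hI
        (f := fun i => eexp (c₀ * k i) * β i) (h := fun _ => ∞) (fun _ _ => le_top)
      rw [hN0, zero_mul, nonpos_iff_eq_zero] at hsum
      rw [hsum]
      simp [hp₀]
    · rw [ENNReal.mul_top hz]; exact le_top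
  obtain ⟨y, hy⟩ := exists_eq_eexp h0 ht
  set s := y / p₀ with hs
  have hys : y = p₀ * s := by rw [hs]; field_simp
  have hmain : ∑' i, I.indicator (fun i => eexp (c₀ * k i) * β i) i ≤
      N * ∑' j : ℤ, eexp s * eexp (-(δ * |((p₀ - p₁) * s - τ) + (-(p₁ * (c₁ - c₀))) * j|)) := by
    refine tsum_indicator_level_le hI fun i hi => ?_
    rcases eq_or_ne (β i) 0 with hb | hb
    · simp [hb]
    obtain ⟨z, hz⟩ := exists_eq_eexp hb (hβ i)
    have h1 := hA i hi
    have h2 := hle i hi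
    rw [hy] at h2
    rw [hz] at h1 h2 ⊢
    simp only [← eexp_add, eexp_rpow, eexp_le_eexp] at h1 h2 ⊢
    -- In logarithms, u measures log a_i against log S / p₀. The ratio condition reads (p₀ - p₁)u +
    -- W ≤ 0 and the bound by S reads p₀u ≤ η((p₀ - p₁)u + W). Together they give u ≤ -δ|W|, and W
    -- runs through an arithmetic progression in `k i` with nonzero step since c₀ ≠ c₁.
    set W := ((p₀ - p₁) * s - τ) + (-(p₁ * (c₁ - c₀))) * (k i : ℝ) with hW
    set u := c₀ * k i + z - s with hu
    have h3 : (p₀ - p₁) * u + W ≤ 0 := by rw [hW, hu]; linarith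
    have h4 : p₀ * u ≤ η * ((p₀ - p₁) * u + W) := by rw [hW, hu]; linarith
    have h5 : u ≤ 0 := by
      have : p₀ * u ≤ 0 := h4.trans (mul_nonpos_of_nonneg_of_nonpos hη0.le h3)
      exact nonpos_of_mul_nonpos_right this hp₀
    have h6 : u ≤ η / e * W := by
      rw [div_mul_eq_mul_div, le_div_iff₀ he, he_def]; linarith
    have h7 : u ≤ 1 / (p₀ + p₁) * (-W) := by
      rw [div_mul_eq_mul_div, le_div_iff₀ (by positivity)]
      nlinarith
    have h8 : u ≤ -(δ * |W|) := by
      rcases le_total W 0 with hW0 | hW0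
      · rw [abs_of_nonpos hW0]
        nlinarith [min_le_left (η / e) (1 / (p₀ + p₁))]
      · rw [abs_of_nonneg hW0]
        nlinarith [min_le_right (η / e) (1 / (p₀ + p₁))]
    linarith
  calc _ ≤ (N * ∑' j : ℤ, eexp s *
          eexp (-(δ * |((p₀ - p₁) * s - τ) + (-(p₁ * (c₁ - c₀))) * j|))) ^ p₀ := by gcongr
    _ ≤ (N * (eexp s * G)) ^ p₀ := by
        rw [ENNReal.tsum_mul_left]; gcongr; exact hgeo _
    _ = (N * G) ^ p₀ * S := by
        rw [mul_left_comm, mul_comm, ENNReal.mul_rpow_of_nonneg _ _ hp₀.le, eexp_rpow, hy, hys,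
          mul_comm s]

/-- The condition restricts m to a half-line on which the terms are e^{-ηm/2}, up to a factor free
of m, so the series is comparable to its first term. Half of η is spent on convergence. -/
theorem tsum_scale_le (hη0 : 0 < η) (hη1 : η < 1) :
    ∃ C : ℝ≥0∞, C ≠ ∞ ∧ ∀ A B : ℝ≥0∞, A ≠ ∞ → B ≠ ∞ →
      ∑' m : ℤ, {m : ℤ | A ≤ eexp m * B}.indicator (fun m : ℤ => eexp (-η * m) *
        (A ^ (1 - η / 2) * (eexp m * B) ^ (η / 2))) m ≤ C * (A ^ (1 - η) * B ^ η) := by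
  obtain ⟨C, hC, hgeo⟩ := tsum_eexp_neg_abs_le (half_pos hη0) one_ne_zero
  refine ⟨C, hC, fun A B hA hB => ?_⟩
  rcases eq_or_ne A 0 with rfl | hA0
  · simp [show 0 < 1 - η / 2 by linarith]
  rcases eq_or_ne B 0 with rfl | hB0
  · simp [hA0]
  obtain ⟨x, rfl⟩ := exists_eq_eexp hA0 hA
  obtain ⟨y, rfl⟩ := exists_eq_eexp hB0 hB
  calc _ ≤ ∑' m : ℤ, eexp (-(η / 2 * |y - x + 1 * m|)) *
          (eexp x ^ (1 - η) * eexp y ^ η) := by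
        refine ENNReal.tsum_le_tsum fun m => ?_
        by_cases hm : eexp x ≤ eexp m * eexp y
        · rw [indicator_of_mem (by exact hm)]
          simp only [← eexp_add, eexp_rpow, eexp_le_eexp] at hm ⊢
          rw [abs_of_nonneg (by linarith)]
          apply le_of_eq; ring
        · rw [indicator_of_notMem (by exact hm)]; exact zero_le
    _ ≤ _ := by
        rw [ENNReal.tsum_mul_right]
        gcongr
        exact hgeo _

/-- Splitting a sequence according to the ratio of `aᵢ^{p₀}` and `bᵢ^{p₁}`: the part with small
ratio. -/
theorem tsum_split_le (k : ι → ℤ) (hp₀ : 0 < p₀) (hp₁ : 0 < p₁) (hc : c₀ ≠ c₁)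
    (hη0 : 0 < η) (hη1 : η < 1) (hN : N ≠ ∞) :
    ∃ C : ℝ≥0∞, C ≠ ∞ ∧ ∀ (β : ι → ℝ≥0∞) (I : Set ι), (∀ i, β i ≠ ∞) →
      (∀ j, ∑' i, (I ∩ k ⁻¹' {j}).indicator 1 i ≤ N) →
      ∑' m : ℤ, eexp (-η * m) * (∑' i, (I ∩ {i | (eexp (c₀ * k i) * β i) ^ p₀ ≤
          eexp m * (eexp (c₁ * k i) * β i) ^ p₁}).indicator
            (fun i => eexp (c₀ * k i) * β i) i) ^ p₀ ≤
        C * ∑' i, I.indicator (fun i => ((eexp (c₀ * k i) * β i) ^ p₀) ^ (1 - η) *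
          ((eexp (c₁ * k i) * β i) ^ p₁) ^ η) i := by
  -- With η/2 in place of η the bound grows only like e^{ηm/2}, which the weight e^{-ηm} absorbs.
  -- The supremum may then be replaced by the sum over i and the two sums exchanged.
  obtain ⟨C₁, hC₁, h₁⟩ := tsum_rpow_le_iSup k hp₀ hp₁ hc (half_pos hη0) (by linarith) hN
  obtain ⟨C₂, hC₂, h₂⟩ := tsum_scale_le hη0 hη1
  refine ⟨C₁ * C₂, ENNReal.mul_ne_top hC₁ hC₂, fun β I hβ hI => ?_⟩
  set A : ι → ℝ≥0∞ := fun i => (eexp (c₀ * k i) * β i) ^ p₀ with hA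
  set B : ι → ℝ≥0∞ := fun i => (eexp (c₁ * k i) * β i) ^ p₁ with hB
  have hAt (i) : A i ≠ ∞ := ENNReal.rpow_ne_top_of_nonneg hp₀.le
    (ENNReal.mul_ne_top (eexp_ne_top _) (hβ i))
  have hBt (i) : B i ≠ ∞ := ENNReal.rpow_ne_top_of_nonneg hp₁.le
    (ENNReal.mul_ne_top (eexp_ne_top _) (hβ i))
  calc _ ≤ ∑' m : ℤ, eexp (-η * m) * (C₁ * ∑' i, (I ∩ {i | A i ≤ eexp m * B i}).indicator
          (fun i => A i ^ (1 - η / 2) * (eexp m * B i) ^ (η / 2)) i) := by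
        refine ENNReal.tsum_le_tsum fun m => ?_
        gcongr
        refine (h₁ β _ m hβ (level_mono inter_subset_left hI) fun i hi => hi.2).trans ?_
        gcongr
        refine iSup₂_le fun i hi => ?_
        refine le_trans ?_ (ENNReal.le_tsum i)
        exact (indicator_of_mem (s := I ∩ {i | A i ≤ eexp m * B i}) hi
          (fun i => A i ^ (1 - η / 2) * (eexp m * B i) ^ (η / 2))).ge
    _ = C₁ * ∑' i, ∑' m : ℤ, eexp (-η * m) * (I ∩ {i | A i ≤ eexp m * B i}).indicator
          (fun i => A i ^ (1 - η / 2) * (eexp m * B i) ^ (η / 2)) i := by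
        rw [ENNReal.tsum_comm, ← ENNReal.tsum_mul_left]
        simp only [← ENNReal.tsum_mul_left]
        refine tsum_congr fun m => tsum_congr fun i => by ring
    _ ≤ C₁ * ∑' i, C₂ * I.indicator (fun i => A i ^ (1 - η) * B i ^ η) i := by
        gcongr with i
        by_cases hi : i ∈ I
        · rw [indicator_of_mem hi]
          refine le_trans (ENNReal.tsum_le_tsum fun m => ?_) (h₂ (A i) (B i) (hAt i) (hBt i))
          by_cases hm : A i ≤ eexp m * B i
          · simp [hi, hm]
          · simp [hm]
        · simp [hi]
    _ = _ := by rw [ENNReal.tsum_mul_left, mul_assoc]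

/-- The converse estimate. -/
theorem tsum_le_tsum_iSup_min (k : ι → ℤ) (hp₀ : 1 ≤ p₀) (hp₁ : 0 < p₁) (hc : c₀ ≠ c₁)
    (hη0 : 0 < η) (hη1 : η < 1) (hN : N ≠ ∞) :
    ∃ C : ℝ≥0∞, C ≠ ∞ ∧ ∀ (β : ι → ℝ≥0∞) (I : Set ι), (∀ i, β i ≠ ∞) →
      (∀ j, ∑' i, (I ∩ k ⁻¹' {j}).indicator 1 i ≤ N) →
      ∑' i, I.indicator (fun i => ((eexp (c₀ * k i) * β i) ^ p₀) ^ (1 - η) *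
          ((eexp (c₁ * k i) * β i) ^ p₁) ^ η) i ≤
        C * ∑' m : ℤ, eexp (-η * m) * ⨆ i ∈ I, min ((eexp (c₀ * k i) * β i) ^ p₀)
          (eexp m * (eexp (c₁ * k i) * β i) ^ p₁) := by
  obtain ⟨C, hC, hsup⟩ := tsum_rpow_le_iSup k (p₀ := p₀) (by linarith) hp₁ hc hη0 hη1 hN
  refine ⟨C * eexp 1, ENNReal.mul_ne_top hC (eexp_ne_top _), fun β I hβ hI => ?_⟩
  set A : ι → ℝ≥0∞ := fun i => (eexp (c₀ * k i) * β i) ^ p₀ with hA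
  set B : ι → ℝ≥0∞ := fun i => (eexp (c₁ * k i) * β i) ^ p₁ with hB
  -- On `J m` the ratio A/B lies between e^m and e^{m+1}, so A and min(A, e^m B) agree up to a
  -- factor e. Every index of `I` with β_i ≠ 0 belongs to some `J m`, namely with m = ⌊log(A/B)⌋.
  set J : ℤ → Set ι := fun m => I ∩ {i | eexp m * B i ≤ A i ∧ A i ≤ eexp (m + 1) * B i} with hJ
  have hp₀' : 0 < p₀ := by linarith
  calc _ ≤ ∑' i, ∑' m : ℤ, eexp (-η * m) * (J m).indicator A i := by
        refine ENNReal.tsum_le_tsum fun i => ?_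
        by_cases hi : i ∈ I
        · rcases eq_or_ne (β i) 0 with hb | hb
          · simp [hi, hb, hp₀', hη1]
          obtain ⟨z, hz⟩ := exists_eq_eexp hb (hβ i)
          have hAi : A i = eexp ((c₀ * k i + z) * p₀) := by
            rw [hA]; simp only [hz, ← eexp_add, eexp_rpow]
          have hBi : B i = eexp ((c₁ * k i + z) * p₁) := by
            rw [hB]; simp only [hz, ← eexp_add, eexp_rpow]
          set α := (c₀ * k i + z) * p₀
          set b := (c₁ * k i + z) * p₁
          refine le_trans ?_ (ENNReal.le_tsum ⌊α - b⌋)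
          have h3 := Int.floor_le (α - b)
          have h4 := Int.lt_floor_add_one (α - b)
          have hmem : i ∈ J ⌊α - b⌋ := by
            refine ⟨hi, ?_, ?_⟩
            · rw [hAi, hBi, ← eexp_add, eexp_le_eexp]; linarith
            · rw [hAi, hBi, ← eexp_add, eexp_le_eexp]; linarith
          rw [indicator_of_mem hi, indicator_of_mem hmem]
          change A i ^ (1 - η) * B i ^ η ≤ _
          simp only [hAi, hBi, eexp_rpow, ← eexp_add, eexp_le_eexp]
          nlinarith
        · simp [hi]
    _ = ∑' m : ℤ, eexp (-η * m) * ∑' i, (J m).indicator A i := by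
        rw [ENNReal.tsum_comm]; simp only [ENNReal.tsum_mul_left]
    _ ≤ ∑' m : ℤ, eexp (-η * m) *
          (C * (eexp 1 * ⨆ i ∈ I, min (A i) (eexp m * B i))) := by
        refine ENNReal.tsum_le_tsum fun m => ?_
        gcongr
        calc ∑' i, (J m).indicator A i
            ≤ (∑' i, (J m).indicator (fun i => eexp (c₀ * k i) * β i) i) ^ p₀ := by
              -- Here `1 ≤ p₀` is needed: the sum of powers is at most the power of the sum.
              refine le_trans (ENNReal.tsum_le_tsum fun i => ?_) (tsum_rpow_le_rpow_tsum hp₀ _)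
              by_cases hi : i ∈ J m
              · simp [hi, hA]
              · simp [hi]
          _ ≤ C * ⨆ i ∈ J m, A i ^ (1 - η) * (eexp (m + 1) * B i) ^ η :=
              hsup β (J m) (m + 1) hβ (level_mono inter_subset_left hI) fun i hi => hi.2.2
          _ ≤ _ := by
              gcongr
              refine iSup₂_le fun i hi => ?_
              have h1 : eexp m * B i ≤ min (A i) (eexp m * B i) := le_min hi.2.1 le_rfl
              calc A i ^ (1 - η) * (eexp (m + 1) * B i) ^ η
                  ≤ (eexp (m + 1) * B i) ^ (1 - η) * (eexp (m + 1) * B i) ^ η := by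
                    gcongr
                    exact hi.2.2
                _ = eexp 1 * (eexp m * B i) := by
                    rw [← ENNReal.rpow_add_of_nonneg _ _ (by linarith) hη0.le, sub_add_cancel,
                      ENNReal.rpow_one, add_comm, eexp_add, mul_assoc]
                _ ≤ _ := by
                    gcongr
                    exact h1.trans (le_iSup₂_of_le (f := fun i _ => min (A i) (eexp m * B i))
                      i hi.1 le_rfl)
    _ = _ := by
        rw [← ENNReal.tsum_mul_left]
        refine tsum_congr fun m => by ring

end Sequences

/-! ### Logarithmic layers of the half-line -/

section HaarPos

theorem haarPos_restrict_Ioc_le {a b : ℝ} (ha : 0 < a) :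
    haarPos.restrict (Ioc a b) ≤ ENNReal.ofReal a⁻¹ • volume.restrict (Ioc a b) := by
  rw [haarPos, restrict_withDensity measurableSet_Ioc, Measure.restrict_restrict measurableSet_Ioc,
    inter_eq_left.2 (show Ioc a b ⊆ Ioi 0 from fun t ht => ha.trans ht.1), ← withDensity_const]
  refine withDensity_mono ?_
  filter_upwards [ae_restrict_mem measurableSet_Ioc] with t ht
  exact ENNReal.ofReal_le_ofReal (inv_anti₀ ha ht.1.le)

theorem le_haarPos_restrict_Ioc {a b : ℝ} (ha : 0 < a) :
    ENNReal.ofReal b⁻¹ • volume.restrict (Ioc a b) ≤ haarPos.restrict (Ioc a b) := by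
  rw [haarPos, restrict_withDensity measurableSet_Ioc, Measure.restrict_restrict measurableSet_Ioc,
    inter_eq_left.2 (show Ioc a b ⊆ Ioi 0 from fun t ht => ha.trans ht.1), ← withDensity_const]
  refine withDensity_mono ?_
  filter_upwards [ae_restrict_mem measurableSet_Ioc] with t ht
  exact ENNReal.ofReal_le_ofReal (inv_anti₀ (ha.trans ht.1) ht.2)

theorem haarPos_Ioc_le {a b : ℝ} (ha : 0 < a) :
    haarPos (Ioc a b) ≤ ENNReal.ofReal (a⁻¹ * (b - a)) := by
  have := haarPos_restrict_Ioc_le (b := b) ha (Ioc a b)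
  simpa [ENNReal.ofReal_mul (inv_pos.2 ha).le] using this

theorem le_haarPos_Ioc {a b : ℝ} (ha : 0 < a) (hb : 0 < b) :
    ENNReal.ofReal (b⁻¹ * (b - a)) ≤ haarPos (Ioc a b) := by
  have := le_haarPos_restrict_Ioc (b := b) ha (Ioc a b)
  simpa [ENNReal.ofReal_mul (inv_pos.2 hb).le] using this

theorem ae_haarPos_pos : ∀ᵐ t ∂haarPos, 0 < t :=
  (withDensity_absolutelyContinuous _ _).ae_le (ae_restrict_mem measurableSet_Ioi)

instance : SFinite haarPos := by unfold haarPos; infer_instance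

variable {l : ℝ}

/-- The `k`-th layer `(e^{lk}, e^{l(k+1)}]` of the half-line. -/
def layer (l : ℝ) (k : ℤ) : Set ℝ := Ioc (Real.exp (l * k)) (Real.exp (l * (k + 1)))

theorem measurableSet_layer (l : ℝ) (k : ℤ) : MeasurableSet (layer l k) := measurableSet_Ioc

theorem exists_mem_layer (hl : 0 < l) {t : ℝ} (ht : 0 < t) : ∃ k, t ∈ layer l k := by
  have h1 := Int.ceil_lt_add_one (Real.log t / l)
  have h2 := Int.le_ceil (Real.log t / l)
  rw [div_le_iff₀ hl] at h2
  rw [← sub_lt_iff_lt_add, lt_div_iff₀ hl] at h1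
  refine ⟨⌈Real.log t / l⌉ - 1, ?_, ?_⟩
  · rw [← Real.lt_log_iff_exp_lt ht]; push_cast; linarith
  · rw [← Real.log_le_iff_le_exp ht]; push_cast; linarith

theorem layer_disjoint (hl : 0 < l) : Pairwise (Function.onFun Disjoint (layer l)) := by
  have key : ∀ i j : ℤ, i < j → Disjoint (layer l i) (layer l j) := by
    intro i j h
    rw [Set.disjoint_left]
    intro t hi hj
    have h1 : (i : ℝ) + 1 ≤ j := by exact_mod_cast h
    have := Real.exp_le_exp.2 (mul_le_mul_of_nonneg_left h1 hl.le)
    exact absurd (hi.2.trans this) (not_le.2 hj.1)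
  intro i j hij
  rcases lt_or_gt_of_ne hij with h | h
  · exact key i j h
  · exact (key j i h).symm

theorem iUnion_layer (hl : 0 < l) : ⋃ k, layer l k = Ioi 0 := by
  ext t
  simp only [mem_iUnion, mem_Ioi]
  exact ⟨fun ⟨k, hk⟩ => (Real.exp_pos _).trans hk.1, exists_mem_layer hl⟩

theorem lintegral_haarPos_eq_tsum (hl : 0 < l) (F : ℝ → ℝ≥0∞) :
    ∫⁻ t, F t ∂haarPos = ∑' k, ∫⁻ t in layer l k, F t ∂haarPos := by
  rw [← lintegral_iUnion (measurableSet_layer l) (layer_disjoint hl), iUnion_layer hl,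
    Measure.restrict_eq_self_of_ae_mem (by exact ae_haarPos_pos)]

/-- Freezing 1/t at the left endpoint gives a bound free of k, in keeping with the dilation
invariance of dt/t; the companion lower bound freezes it at the right endpoint. -/
theorem haarPos_layer_le (l : ℝ) (k : ℤ) :
    haarPos (layer l k) ≤ ENNReal.ofReal (Real.exp l - 1) := by
  refine (haarPos_Ioc_le (Real.exp_pos _)).trans (ENNReal.ofReal_le_ofReal (le_of_eq ?_))
  rw [mul_add, mul_one, Real.exp_add]
  field_simp

theorem le_haarPos_layer (l : ℝ) (k : ℤ) :
    ENNReal.ofReal (1 - Real.exp (-l)) ≤ haarPos (layer l k) := by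
  refine le_trans (ENNReal.ofReal_le_ofReal (le_of_eq ?_))
    (le_haarPos_Ioc (Real.exp_pos _) (Real.exp_pos _))
  rw [mul_add, mul_one, Real.exp_add, Real.exp_neg]
  field_simp

end HaarPos

/-! ### Real interpolation norms through the L-functional -/

section Limits

theorem tendsto_eexp_atBot : Tendsto eexp atBot (𝓝 0) := by
  have := ENNReal.tendsto_ofReal Real.tendsto_exp_atBot
  rwa [ENNReal.ofReal_zero] at this

/-- Terms of a convergent weighted sum are bounded by the sum, and undoing a growing weight forces
decay. This provides the limits required by `tsum_interpolation_le`. -/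
theorem tendsto_zero_of_le_eexp {α : Type*} {F : Filter α} {u : α → ℝ≥0∞} {v : α → ℝ}
    {R : ℝ≥0∞} {q : ℝ} (hq : 0 < q) (hR : R ≠ ∞) (hv : Tendsto v F atBot)
    (h : ∀ m, eexp (-v m) * u m ^ q ≤ R) : Tendsto u F (𝓝 0) := by
  have h1 : Tendsto (fun m => (eexp (v m) * R) ^ (1 / q)) F (𝓝 0) := by
    have h2 := ENNReal.Tendsto.mul_const (tendsto_eexp_atBot.comp hv) (Or.inr hR)
    have h3 := h2.ennrpow_const (1 / q)
    simpa [hq] using h3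
  refine tendsto_of_tendsto_of_tendsto_of_le_of_le tendsto_const_nhds h1 (fun _ => zero_le)
    fun m => ?_
  rw [one_div, ENNReal.le_rpow_inv_iff hq]
  calc u m ^ q = eexp (v m) * (eexp (-v m) * u m ^ q) := by
        rw [← mul_assoc, eexp_mul_neg_cancel, one_mul]
    _ ≤ _ := by gcongr; exact h m

theorem rpow_mul_rpow_le_add {η : ℝ} (h0 : 0 ≤ η) (h1 : η ≤ 1) (x y : ℝ≥0∞) :
    x ^ (1 - η) * y ^ η ≤ x + y := by
  have h2 : 0 ≤ 1 - η := by linarith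
  calc x ^ (1 - η) * y ^ η ≤ (x + y) ^ (1 - η) * (x + y) ^ η := by
        gcongr
        · exact le_self_add
        · exact le_add_self
    _ = x + y := by
        rw [← ENNReal.rpow_add_of_nonneg _ _ h2 h0, sub_add_cancel, ENNReal.rpow_one]

end Limits

section Interpolation

variable {A : Type*} [AddCommGroup A] {N₀ N₁ : A → ℝ≥0∞} {p₀ p₁ θ p η : ℝ}

theorem kFunctional_mono {s t : ℝ} (h : s ≤ t) (a : A) :
    kFunctional N₀ N₁ s a ≤ kFunctional N₀ N₁ t a :=
  iInf_mono fun _ => iInf_mono fun _ => iInf_mono fun _ => by gcongr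

theorem kFunctional_mul_le {c t : ℝ} (hc : 1 ≤ c) (a : A) :
    kFunctional N₀ N₁ (c * t) a ≤ ENNReal.ofReal c * kFunctional N₀ N₁ t a := by
  have hc' : ENNReal.ofReal c ≠ 0 := by simp; linarith
  simp only [kFunctional, ENNReal.mul_iInf_of_ne hc' ENNReal.ofReal_ne_top]
  refine iInf_mono fun _ => iInf_mono fun _ => iInf_mono fun _ => ?_
  rw [mul_add, ENNReal.ofReal_mul (by linarith), mul_assoc]
  gcongr
  exact le_mul_of_one_le_left zero_le (by simpa using hc)

/-- The `L`-functional `inf (‖a₀‖^{p₀} + e^m ‖a₁‖^{p₁})`. -/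
noncomputable def lFunctional (N₀ N₁ : A → ℝ≥0∞) (p₀ p₁ m : ℝ) (a : A) : ℝ≥0∞ :=
  ⨅ (a₀ : A) (a₁ : A) (_ : a₀ + a₁ = a), N₀ a₀ ^ p₀ + eexp m * N₁ a₁ ^ p₁

theorem realInterpNorm_rpow (hp : 0 < p) (a : A) : realInterpNorm N₀ N₁ θ p a ^ p =
    ∫⁻ t, (ENNReal.ofReal (t ^ (-θ)) * kFunctional N₀ N₁ t a) ^ p ∂haarPos := by
  rw [realInterpNorm, ← ENNReal.rpow_mul, one_div_mul_cancel hp.ne', ENNReal.rpow_one]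

/-- K(t) increases and K(t)/t decreases, so K and t^{-θ} each change by a bounded factor on a layer
of ratio e. -/
theorem realInterpNorm_rpow_le_tsum (h0 : 0 < θ) (hp : 0 < p) :
    ∃ C : ℝ≥0∞, C ≠ ∞ ∧ ∀ (N₀ N₁ : A → ℝ≥0∞) (a : A), realInterpNorm N₀ N₁ θ p a ^ p ≤
      C * ∑' m : ℤ, (eexp (-θ * m) * kFunctional N₀ N₁ (Real.exp m) a) ^ p := by
  refine ⟨eexp 1 ^ p * ENNReal.ofReal (Real.exp 1 - 1), ENNReal.mul_ne_top
    (ENNReal.rpow_ne_top_of_nonneg hp.le (eexp_ne_top _)) ENNReal.ofReal_ne_top,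
    fun N₀ N₁ a => ?_⟩
  rw [realInterpNorm_rpow hp, lintegral_haarPos_eq_tsum one_pos, ← ENNReal.tsum_mul_left]
  refine ENNReal.tsum_le_tsum fun m => ?_
  calc _ ≤ ∫⁻ t in layer 1 m, (eexp (-θ * m) *
          (eexp 1 * kFunctional N₀ N₁ (Real.exp m) a)) ^ p ∂haarPos := by
        refine setLIntegral_mono' (measurableSet_layer _ _) fun t ht => ?_
        have ht' := ht
        simp only [layer, one_mul, mem_Ioc] at ht'
        refine ENNReal.rpow_le_rpow (mul_le_mul' ?_ ?_) hp.le
        · rw [eexp, mul_comm, Real.exp_mul]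
          exact ENNReal.ofReal_le_ofReal
            (Real.rpow_le_rpow_of_nonpos (Real.exp_pos _) ht'.1.le (by linarith))
        · refine (kFunctional_mono ht'.2 a).trans ?_
          rw [add_comm, Real.exp_add]
          exact kFunctional_mul_le (Real.one_le_exp zero_le_one) a
    _ ≤ _ := by
        rw [setLIntegral_const, mul_left_comm, ENNReal.mul_rpow_of_nonneg _ _ hp.le, mul_assoc,
          mul_assoc, mul_comm _ (haarPos _)]
        gcongr
        exact haarPos_layer_le _ _

theorem tsum_le_realInterpNorm_rpow (h0 : 0 < θ) (hp : 0 < p) :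
    ∃ C : ℝ≥0∞, C ≠ ∞ ∧ ∀ (N₀ N₁ : A → ℝ≥0∞) (a : A),
      ∑' m : ℤ, (eexp (-θ * m) * kFunctional N₀ N₁ (Real.exp m) a) ^ p ≤
        C * realInterpNorm N₀ N₁ θ p a ^ p := by
  have hc : ENNReal.ofReal (1 - Real.exp (-1)) ≠ 0 := by simp
  refine ⟨eexp θ ^ p * (ENNReal.ofReal (1 - Real.exp (-1)))⁻¹, ENNReal.mul_ne_top
    (ENNReal.rpow_ne_top_of_nonneg hp.le (eexp_ne_top _)) (ENNReal.inv_ne_top.2 hc),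
    fun N₀ N₁ a => ?_⟩
  rw [realInterpNorm_rpow hp, lintegral_haarPos_eq_tsum one_pos, ← ENNReal.tsum_mul_left]
  refine ENNReal.tsum_le_tsum fun m => ?_
  calc _ = eexp θ ^ p * (ENNReal.ofReal (1 - Real.exp (-1)))⁻¹ *
        ((eexp (-θ * (m + 1)) * kFunctional N₀ N₁ (Real.exp m) a) ^ p *
          ENNReal.ofReal (1 - Real.exp (-1))) := by
        rw [show ∀ a b c d : ℝ≥0∞, a * b * (c * d) = b * d * (a * c) by intros; ring,
          ENNReal.inv_mul_cancel hc ENNReal.ofReal_ne_top, one_mul,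
          ← ENNReal.mul_rpow_of_nonneg _ _ hp.le, ← mul_assoc, ← eexp_add]
        congr 3; ring
    _ ≤ eexp θ ^ p * (ENNReal.ofReal (1 - Real.exp (-1)))⁻¹ * ∫⁻ t in layer 1 m,
          (eexp (-θ * (m + 1)) * kFunctional N₀ N₁ (Real.exp m) a) ^ p ∂haarPos := by
        rw [setLIntegral_const]
        gcongr
        exact le_haarPos_layer _ _
    _ ≤ _ := by
        gcongr _ * ?_
        refine setLIntegral_mono' (measurableSet_layer _ _) fun t ht => ?_
        have ht' := ht
        simp only [layer, one_mul, mem_Ioc] at ht'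
        refine ENNReal.rpow_le_rpow (mul_le_mul' ?_ (kFunctional_mono ht'.1.le a)) hp.le
        rw [eexp, mul_comm, Real.exp_mul]
        exact ENNReal.ofReal_le_ofReal (Real.rpow_le_rpow_of_nonpos
          ((Real.exp_pos _).trans ht'.1) ht'.2 (by linarith))

/-- Relations between the parameters of the `K`- and the `L`-functional. -/
structure PowerParams (p₀ p₁ θ p η : ℝ) : Prop where
  one_lt_p₀ : 1 < p₀
  one_lt_p₁ : 1 < p₁
  one_lt_p : 1 < p
  θ_pos : 0 < θ
  θ_lt : θ < 1
  η_pos : 0 < η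
  η_lt : η < 1
  mul_one_sub : p₀ * (1 - η) = (1 - θ) * p
  mul_eq : p₁ * η = θ * p

/-- A family of decompositions bounds the real interpolation norm. -/
theorem realInterpNorm_rpow_le_of_decomp (h : PowerParams p₀ p₁ θ p η) :
    ∃ C : ℝ≥0∞, C ≠ ∞ ∧ ∀ (N₀ N₁ : A → ℝ≥0∞) (a : A) (f g : ℤ → A), (∀ m, f m + g m = a) →
      realInterpNorm N₀ N₁ θ p a ^ p ≤ C * (∑' m : ℤ, eexp (-η * m) * N₀ (f m) ^ p₀ +
        ∑' m : ℤ, eexp ((1 - η) * m) * N₁ (g m) ^ p₁) := by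
  have hp : 0 < p := by linarith [h.one_lt_p]
  have hp₀ : 0 < p₀ := by linarith [h.one_lt_p₀]
  have hp₁ : 0 < p₁ := by linarith [h.one_lt_p₁]
  have hη := h.η_pos
  have hη' : 0 < 1 - η := by linarith [h.η_lt]
  obtain ⟨C₁, hC₁, h₁⟩ := realInterpNorm_rpow_le_tsum (A := A) h.θ_pos hp
  obtain ⟨C₂, hC₂, h₂⟩ := tsum_interpolation_le h.θ_pos h.θ_lt hp
  refine ⟨C₁ * C₂ * eexp η + 1, by
    simpa using ENNReal.mul_ne_top (ENNReal.mul_ne_top hC₁ hC₂) (eexp_ne_top _),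
    fun N₀ N₁ a f g hfg => ?_⟩
  set R₀ := ∑' m : ℤ, eexp (-η * m) * N₀ (f m) ^ p₀ with hR₀
  set R₁ := ∑' m : ℤ, eexp ((1 - η) * m) * N₁ (g m) ^ p₁ with hR₁
  by_cases hR : R₀ + R₁ = ∞
  · rw [hR, ENNReal.mul_top (by simp)]; exact le_top
  simp only [ENNReal.add_eq_top, not_or] at hR
  refine (h₁ N₀ N₁ a).trans ?_
  have hd : Tendsto (fun m => N₀ (f m)) atBot (𝓝 0) := by
    refine tendsto_zero_of_le_eexp hp₀ hR.1
      ((tendsto_intCast_atBot_iff.2 tendsto_id).const_mul_atBot hη) fun m => ?_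
    rw [← neg_mul]
    exact ENNReal.le_tsum m
  have he : Tendsto (fun m => N₁ (g m)) atTop (𝓝 0) := by
    refine tendsto_zero_of_le_eexp hp₁ hR.2
      (tendsto_intCast_atTop_atTop.const_mul_atTop_of_neg (neg_lt_zero.2 hη')) fun m => ?_
    rw [neg_mul, neg_neg]
    exact ENNReal.le_tsum m
  -- The index m of the decompositions lives on the scale of the L-functional and is unrelated to
  -- the scale l of K. Every pair (l, m) is admissible, and `tsum_interpolation_le` makes the
  -- choice.
  calc C₁ * ∑' m : ℤ, (eexp (-θ * m) * kFunctional N₀ N₁ (Real.exp m) a) ^ p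
      ≤ C₁ * (C₂ * ∑' m : ℤ, N₀ (f (m + 1)) ^ ((1 - θ) * p) * N₁ (g m) ^ (θ * p)) := by
        gcongr
        refine h₂ _ _ _ (fun l m => ?_) hd he
        exact iInf_le_of_le (f m) (iInf_le_of_le (g m) (iInf_le_of_le (hfg m) le_rfl))
    -- The inserted weights e^{-ηm} and e^{(1-η)m} cancel after taking the powers 1 - η and η; e^η
    -- compensates the shift to m + 1.
    _ ≤ C₁ * (C₂ * ∑' m : ℤ, (eexp η * (eexp (-η * (m + 1 : ℤ)) * N₀ (f (m + 1)) ^ p₀) +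
          eexp ((1 - η) * m) * N₁ (g m) ^ p₁)) := by
        gcongr with m
        refine le_trans (le_of_eq ?_) (rpow_mul_rpow_le_add hη.le h.η_lt.le _ _)
        rw [← mul_assoc, ← eexp_add, ENNReal.mul_rpow_of_nonneg _ _ hη'.le,
          ENNReal.mul_rpow_of_nonneg _ _ hη.le, mul_mul_mul_comm, eexp_rpow, eexp_rpow, ← eexp_add,
          ← ENNReal.rpow_mul, ← ENNReal.rpow_mul, h.mul_one_sub, h.mul_eq,
          show (η + -η * ((m + 1 : ℤ) : ℝ)) * (1 - η) + (1 - η) * m * η = 0 by push_cast; ring,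
          eexp_zero, one_mul]
    _ = C₁ * (C₂ * (eexp η * R₀ + R₁)) := by
        rw [ENNReal.tsum_add, ENNReal.tsum_mul_left, ← hR₁, hR₀,
          ← (Equiv.addRight (1 : ℤ)).tsum_eq fun m : ℤ => eexp (-η * m) * N₀ (f m) ^ p₀]
        rfl
    _ ≤ C₁ * (C₂ * (eexp η * R₀ + eexp η * R₁)) := by
        gcongr
        exact le_mul_of_one_le_left zero_le (by rw [← eexp_zero, eexp_le_eexp]; exact hη.le)
    _ = C₁ * C₂ * eexp η * (R₀ + R₁) := by ring
    _ ≤ _ := by gcongr; exact le_self_add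

/-- The `L`-functional is controlled by the real interpolation norm. -/
theorem tsum_lFunctional_le (h : PowerParams p₀ p₁ θ p η) :
    ∃ C : ℝ≥0∞, C ≠ ∞ ∧ ∀ (N₀ N₁ : A → ℝ≥0∞) (a : A),
      ∑' m : ℤ, eexp (-η * m) * lFunctional N₀ N₁ p₀ p₁ m a ≤
        C * realInterpNorm N₀ N₁ θ p a ^ p := by
  have hp : 0 < p := by linarith [h.one_lt_p]
  have hp₀ : 0 < p₀ := by linarith [h.one_lt_p₀]
  have hp₁ : 0 < p₁ := by linarith [h.one_lt_p₁]
  have hθ := h.θ_pos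
  have hθ' : 0 < 1 - θ := by linarith [h.θ_lt]
  obtain ⟨C₁, hC₁, h₁⟩ := tsum_le_realInterpNorm_rpow (A := A) hθ hp
  -- The same discrete estimate with the roles exchanged: L is now the interpolated quantity, with
  -- parameter η and exponent 1, and it is bounded by powers of K.
  obtain ⟨C₂, hC₂, h₂⟩ := tsum_interpolation_le h.η_pos h.η_lt one_pos
  refine ⟨C₂ * eexp ((1 - θ) * p) * C₁ + 1, by
    simpa using ENNReal.mul_ne_top (ENNReal.mul_ne_top hC₂ (eexp_ne_top _)) hC₁,
    fun N₀ N₁ a => ?_⟩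
  set K : ℤ → ℝ≥0∞ := fun m => kFunctional N₀ N₁ (Real.exp m) a with hK
  set R := ∑' m : ℤ, (eexp (-θ * m) * K m) ^ p with hRdef
  by_cases hRt : realInterpNorm N₀ N₁ θ p a ^ p = ∞
  · rw [hRt, ENNReal.mul_top (by simp)]; exact le_top
  have hR : R ≠ ∞ := ne_top_of_le_ne_top (ENNReal.mul_ne_top hC₁ hRt) (h₁ N₀ N₁ a)
  have hKt (m : ℤ) : K m ≠ ∞ := by
    intro ht
    refine hR (top_le_iff.1 (le_trans ?_ (ENNReal.le_tsum m)))
    simp [ht, hp]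
  have hterm (m : ℤ) : eexp (-(θ * p * m)) * K m ^ p ≤ R := by
    refine le_trans (le_of_eq ?_) (ENNReal.le_tsum m)
    rw [ENNReal.mul_rpow_of_nonneg _ _ hp.le, eexp_rpow]
    congr 2; ring
  have hd : Tendsto (fun m => K m ^ p₀) atBot (𝓝 0) := by
    have : Tendsto K atBot (𝓝 0) := tendsto_zero_of_le_eexp hp hR
      ((tendsto_intCast_atBot_iff.2 tendsto_id).const_mul_atBot (mul_pos hθ hp)) hterm
    simpa [hp₀] using this.ennrpow_const p₀
  have he : Tendsto (fun m : ℤ => (eexp (-m) * K m) ^ p₁) atTop (𝓝 0) := by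
    have : Tendsto (fun m : ℤ => eexp (-m) * K m) atTop (𝓝 0) := by
      refine tendsto_zero_of_le_eexp hp hR (tendsto_intCast_atTop_atTop.const_mul_atTop_of_neg
        (neg_lt_zero.2 (mul_pos hθ' hp))) fun m => ?_
      refine le_trans (le_of_eq ?_) (hterm m)
      rw [ENNReal.mul_rpow_of_nonneg _ _ hp.le, ← mul_assoc, eexp_rpow, ← eexp_add]
      congr 2; ring
    simpa [hp₁] using this.ennrpow_const p₁
  -- A decomposition nearly optimal for K at e^m is tested in L at e^l. The infimum need not be
  -- attained, so the bound is proved for each c > `K m` and passed to the limit by continuity.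
  have hL (l m : ℤ) : lFunctional N₀ N₁ p₀ p₁ l a ≤
      K m ^ p₀ + eexp l * (eexp (-m) * K m) ^ p₁ := by
    have hcont : Continuous fun c : ℝ≥0∞ => c ^ p₀ + eexp l * (eexp (-m) * c) ^ p₁ := by
      refine ENNReal.continuous_rpow_const.add
        ((ENNReal.continuous_const_mul (eexp_ne_top _)).comp ?_)
      exact ENNReal.continuous_rpow_const.comp (ENNReal.continuous_const_mul (eexp_ne_top _))
    have : NeBot (𝓝[Ioi (K m)] (K m)) := nhdsGT_neBot_of_exists_gt ⟨∞, (hKt m).lt_top⟩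
    refine ge_of_tendsto (x := 𝓝[>] (K m)) ((hcont.tendsto (K m)).mono_left nhdsWithin_le_nhds) ?_
    filter_upwards [self_mem_nhdsWithin] with c hc
    simp only [hK, mem_Ioi, kFunctional, iInf_lt_iff] at hc
    obtain ⟨a₀, a₁, haa, hlt⟩ := hc
    refine iInf_le_of_le a₀ (iInf_le_of_le a₁ (iInf_le_of_le haa ?_))
    have h3 : N₀ a₀ ≤ c := le_self_add.trans hlt.le
    have h4 : N₁ a₁ ≤ eexp (-m) * c := by
      calc N₁ a₁ = eexp (-m) * (eexp m * N₁ a₁) := by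
            rw [← mul_assoc, eexp_neg_mul_cancel, one_mul]
        _ ≤ _ := by gcongr; exact le_add_self.trans hlt.le
    gcongr
  have hG := h₂ _ _ (fun l : ℤ => lFunctional N₀ N₁ p₀ p₁ l a) hL hd he
  simp only [ENNReal.rpow_one, mul_one] at hG
  refine hG.trans ?_
  calc _ ≤ C₂ * ∑' m : ℤ, eexp ((1 - θ) * p) * (eexp (-θ * m) * K m) ^ p := by
        gcongr _ * ?_
        refine ENNReal.tsum_le_tsum fun m => ?_
        have hK1 : K (m + 1) ≤ eexp 1 * K m := by
          rw [hK]; push_cast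
          rw [add_comm, Real.exp_add]
          exact kFunctional_mul_le (Real.one_le_exp zero_le_one) a
        calc (K (m + 1) ^ p₀) ^ (1 - η) * ((eexp (-m) * K m) ^ p₁) ^ η
            = K (m + 1) ^ ((1 - θ) * p) * (eexp (-m) * K m) ^ (θ * p) := by
              rw [← ENNReal.rpow_mul, ← ENNReal.rpow_mul, h.mul_one_sub, h.mul_eq]
          _ ≤ (eexp 1 * K m) ^ ((1 - θ) * p) * (eexp (-m) * K m) ^ (θ * p) := by gcongr
          _ = eexp ((1 - θ) * p) * (eexp (-θ * m) * K m) ^ p := by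
              have hK2 : K m ^ p = K m ^ ((1 - θ) * p) * K m ^ (θ * p) := by
                rw [← ENNReal.rpow_add_of_nonneg _ _ (by positivity) (by positivity)]
                congr 1; ring
              rw [ENNReal.mul_rpow_of_nonneg _ _ (by positivity),
                ENNReal.mul_rpow_of_nonneg _ _ (by positivity),
                ENNReal.mul_rpow_of_nonneg _ _ hp.le, eexp_rpow, eexp_rpow, eexp_rpow, hK2,
                one_mul, show -(m : ℝ) * (θ * p) = -θ * m * p by ring]
              ring
    _ = C₂ * eexp ((1 - θ) * p) * R := by rw [ENNReal.tsum_mul_left, mul_assoc]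
    _ ≤ C₂ * eexp ((1 - θ) * p) * (C₁ * realInterpNorm N₀ N₁ θ p a ^ p) := by
        gcongr; exact h₁ N₀ N₁ a
    _ ≤ _ := by rw [← mul_assoc]; gcongr; exact le_self_add

end Interpolation

/-! ### Volumes, separated nets and grids -/

section Regular

variable {X : Type*} [MetricSpace X] [MeasurableSpace X] {μ : Measure X} {n c : ℝ}

/-- AD-regularity at all radii, in exponential form. -/
structure IsRegular (μ : Measure X) (n c : ℝ) : Prop where
  n_pos : 0 < n
  c_nonneg : 0 ≤ c
  le_ball : ∀ (x : X) (u : ℝ), eexp (n * u - c) ≤ μ (Metric.ball x (Real.exp u))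
  ball_le : ∀ (x : X) (u : ℝ), μ (Metric.ball x (Real.exp u)) ≤ eexp (n * u + c)

theorem exists_isRegular (hAD : IsADRegular μ) (hX : ¬ Bornology.IsBounded (univ : Set X)) :
    ∃ n c, IsRegular μ n c := by
  obtain ⟨n, hn, C, hC, h⟩ := hAD
  have hC0 : 0 < C := by linarith
  have hlt (r : ℝ) : ENNReal.ofReal r < Metric.ediam (univ : Set X) := by
    have : Metric.ediam (univ : Set X) = ∞ := by
      by_contra hne
      exact hX (Metric.isBounded_iff_ediam_ne_top.2 hne)
    rw [this]; exact ENNReal.ofReal_lt_top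
  refine ⟨n, Real.log C, hn, Real.log_nonneg hC, fun x u => ?_, fun x u => ?_⟩
  · refine le_trans (le_of_eq ?_) (h x _ (Real.exp_pos u) (hlt _)).1
    rw [eexp, sub_eq_add_neg, Real.exp_add, Real.exp_neg, Real.exp_log hC0, ← Real.exp_mul,
      mul_comm, mul_comm n]
  · refine (h x _ (Real.exp_pos u) (hlt _)).2.trans (le_of_eq ?_)
    rw [eexp, Real.exp_add, Real.exp_log hC0, ← Real.exp_mul, mul_comm, mul_comm n]

namespace IsRegular

theorem sigmaFinite (h : IsRegular μ n c) : SigmaFinite μ := by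
  rcases isEmpty_or_nonempty X with he | ⟨⟨x⟩⟩
  · rw [Measure.eq_zero_of_isEmpty μ]; infer_instance
  refine ⟨⟨⟨fun m => Metric.ball x (Real.exp m), fun _ => trivial,
    fun m => (h.ball_le x m).trans_lt (eexp_ne_top _).lt_top, ?_⟩⟩⟩
  refine eq_univ_of_forall fun y => mem_iUnion.2 ?_
  obtain ⟨m, hm⟩ := exists_nat_gt (dist y x)
  exact ⟨m, hm.trans (by linarith [Real.add_one_le_exp (m : ℝ)])⟩

/-- Packing: since 2 ≤ e, balls of radius e^{u-1} about e^u-separated points are disjoint, and those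
in question lie in one ball of radius e^{max(u,v)+1}. Comparing volumes bounds their number. -/
theorem tsum_separated_le [BorelSpace X] (h : IsRegular μ n c) {S : Set X} {u : ℝ}
    (hS : S.Pairwise fun x y => Real.exp u < dist x y) (x : X) (v : ℝ) :
    ∑' y : S, {y : S | dist (y : X) x < Real.exp v}.indicator (1 : S → ℝ≥0∞) y ≤
      eexp (n * (max u v - u + 2) + 2 * c) := by
  set T : Set S := {y : S | dist (y : X) x < Real.exp v} with hT
  have h2 : Real.exp (u - 1) * 2 ≤ Real.exp u := by
    have : Real.exp u = Real.exp (u - 1) * Real.exp 1 := by rw [← Real.exp_add]; ring_nf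
    rw [this]
    have := Real.add_one_le_exp (1 : ℝ)
    have := Real.exp_pos (u - 1)
    nlinarith
  have hdisj : Pairwise (Function.onFun Disjoint
      fun y : T => Metric.ball ((y : S) : X) (Real.exp (u - 1))) := by
    intro y z hyz
    apply Metric.ball_disjoint_ball
    have : ((y : S) : X) ≠ ((z : S) : X) := fun he => hyz (Subtype.ext (Subtype.ext he))
    have := hS y.1.2 z.1.2 this
    linarith
  have hsub : (⋃ y : T, Metric.ball ((y : S) : X) (Real.exp (u - 1))) ⊆
      Metric.ball x (Real.exp (max u v + 1)) := by
    refine iUnion_subset fun y => Metric.ball_subset_ball' ?_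
    have h3 : dist ((y : S) : X) x < Real.exp v := y.2
    have h4 := Real.exp_le_exp.2 (le_max_left u v)
    have h5 := Real.exp_le_exp.2 (le_max_right u v)
    rw [Real.exp_add]
    have := Real.add_one_le_exp (1 : ℝ)
    have := Real.exp_pos (max u v)
    have := Real.exp_pos (u - 1)
    nlinarith
  have hmeas := tsum_meas_le_meas_iUnion_of_disjoint μ
    (fun y : T => (Metric.isOpen_ball (x := ((y : S) : X)) (ε := Real.exp (u - 1))).measurableSet)
    hdisj
  have hlow : eexp (n * (u - 1) - c) * ∑' y : S, T.indicator (1 : S → ℝ≥0∞) y ≤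
      eexp (n * (max u v + 1) + c) := by
    rw [← tsum_subtype, ← ENNReal.tsum_mul_left]
    refine le_trans (ENNReal.tsum_le_tsum fun y => ?_)
      (hmeas.trans ((measure_mono hsub).trans (h.ball_le _ _)))
    simpa using h.le_ball _ _
  calc _ = eexp (-(n * (u - 1) - c)) * (eexp (n * (u - 1) - c) *
        ∑' y : S, T.indicator (1 : S → ℝ≥0∞) y) := by
        rw [← mul_assoc, eexp_neg_mul_cancel, one_mul]
    _ ≤ eexp (-(n * (u - 1) - c)) * eexp (n * (max u v + 1) + c) := by gcongr
    _ = _ := by rw [← eexp_add]; congr 1; ring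

end IsRegular

/-- A maximal r-separated set works: a point farther than r from all of it could be added. -/
theorem exists_separated_net (X : Type*) [MetricSpace X] {r : ℝ} (hr : 0 ≤ r) :
    ∃ S : Set X, (S.Pairwise fun x y => r < dist x y) ∧ ∀ x, ∃ y ∈ S, dist x y ≤ r := by
  obtain ⟨S, hS⟩ := zorn_subset {S : Set X | S.Pairwise fun x y => r < dist x y} (by
    intro c hc hchain
    refine ⟨⋃₀ c, ?_, fun s hs => subset_sUnion_of_mem hs⟩
    exact (pairwise_sUnion hchain.directedOn).2 hc)
  refine ⟨S, hS.prop, fun x => ?_⟩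
  by_contra! hx
  have hins : insert x S ∈ {S : Set X | S.Pairwise fun x y => r < dist x y} := by
    refine hS.prop.insert fun y hy _ => ⟨hx y hy, by rw [dist_comm]; exact hx y hy⟩
  have hxS : x ∈ S := hS.le_of_ge hins (subset_insert _ _) (mem_insert _ _)
  have := hx x hxS
  simp at this
  linarith

/-- A family of centres `ctr i`, with scale indices `k i`, whose balls of radius
`e^{l k i - a}` cover `X` at each scale, with bounded overlap. -/
structure IsGrid {ι : Type*} (k : ι → ℤ) (ctr : ι → X) (l a : ℝ) : Prop where
  cover : ∀ (j : ℤ) (x : X), ∃ i, k i = j ∧ dist x (ctr i) < Real.exp (l * j - a)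
  count : ∀ v : ℝ, ∃ N : ℝ≥0∞, N ≠ ∞ ∧ ∀ (x : X) (j : ℤ),
    ∑' i, ({i | dist (ctr i) x < Real.exp (l * k i + v)} ∩ k ⁻¹' {j}).indicator 1 i ≤ N

end Regular

theorem IsRegular.exists_isGrid {X : Type*} [MetricSpace X] [MeasurableSpace X] [BorelSpace X]
    {μ : Measure X} {n c : ℝ} (h : IsRegular μ n c) (l a : ℝ) :
    ∃ (S : ℤ → Set X), (∀ j, (S j).Countable) ∧
      IsGrid (ι := Σ j, S j) (fun i => i.1) (fun i => (i.2 : X)) l a := by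
  -- The extra -1 in the exponent turns the non-strict covering inequality of a net into the strict
  -- one of a grid.
  choose S hS hcov using fun j : ℤ => exists_separated_net X (Real.exp_pos (l * j - a - 1)).le
  refine ⟨S, fun j => ?_, fun j x => ?_, fun v => ?_⟩
  · rcases isEmpty_or_nonempty X with he | ⟨⟨x⟩⟩
    · exact (Set.toFinite _).countable
    have hfin (m : ℕ) : ({y : S j | dist (y : X) x < Real.exp m}).Finite := by
      have := ENNReal.finite_const_le_of_tsum_ne_top (ε := 1)
        (ne_top_of_le_ne_top (eexp_ne_top _) (h.tsum_separated_le (hS j) x m)) one_ne_zero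
      refine this.subset fun y hy => ?_
      change dist (y : X) x < Real.exp m at hy
      simp [hy]
    have hun : (univ : Set (S j)) = ⋃ m : ℕ, {y : S j | dist (y : X) x < Real.exp m} := by
      refine (eq_univ_of_forall fun y => mem_iUnion.2 ?_).symm
      obtain ⟨m, hm⟩ := exists_nat_gt (dist (y : X) x)
      exact ⟨m, hm.trans (by linarith [Real.add_one_le_exp (m : ℝ)])⟩
    have : (univ : Set (S j)).Countable := by
      rw [hun]; exact countable_iUnion fun m => (hfin m).countable
    exact countable_coe_iff.1 (countable_univ_iff.1 this)
  · obtain ⟨y, hy, hxy⟩ := hcov j x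
    exact ⟨⟨j, y, hy⟩, rfl, hxy.trans_lt (Real.exp_lt_exp.2 (by linarith))⟩
  · refine ⟨eexp (n * (max (-a - 1) v - (-a - 1) + 2) + 2 * c), eexp_ne_top _, fun x j => ?_⟩
    rw [ENNReal.tsum_sigma', tsum_eq_single j]
    · refine le_trans (le_of_eq ?_) ((h.tsum_separated_le (hS j) x (l * j + v)).trans
        (le_of_eq ?_))
      · refine tsum_congr fun y => ?_
        by_cases hy : dist (y : X) x < Real.exp (l * j + v) <;> simp [hy, indicator]
      -- Separation and radius both carry the factor e^{lj}, so the count does not depend on the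
      -- scale.
      · rw [show l * j - a - 1 = l * j + (-a - 1) by ring, max_add_add_left]
        congr 3; ring
    · intro j' hj'
      simp [indicator, hj']

/-! ### Box norms and the Lusin function -/

section Boxes

variable {X : Type*} [MetricSpace X] [MeasurableSpace X] {μ : Measure X} {n c : ℝ}
  {ι : Type*} {k : ι → ℤ} {ctr : ι → X} {l a : ℝ} {q s : ℝ}

/-- The box over the ball with centre `ctr i` at scale `k i`. -/
def box (k : ι → ℤ) (ctr : ι → X) (l a : ℝ) (i : ι) : Set (X × ℝ) :=
  Metric.ball (ctr i) (Real.exp (l * k i - a)) ×ˢ layer l (k i)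

/-- The normalised `L^q`-norm of `f` on a box. -/
noncomputable def boxNorm (μ : Measure X) (n q : ℝ) (k : ι → ℤ) (ctr : ι → X) (l a : ℝ)
    (f : X × ℝ → ℂ) (i : ι) : ℝ≥0∞ :=
  (eexp (-(n * l * k i)) * ∫⁻ z in box k ctr l a i, ‖f z‖ₑ ^ q ∂(halfSpaceMeasure μ)) ^ (1 / q)

theorem ae_halfSpaceMeasure_pos {X : Type*} [MeasurableSpace X] (μ : Measure X) : ∀ᵐ z ∂(halfSpaceMeasure μ), 0 < z.2 :=
  Measure.quasiMeasurePreserving_snd.ae ae_haarPos_pos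

theorem measurableSet_box [BorelSpace X] (i : ι) : MeasurableSet (box k ctr l a i) :=
  Metric.isOpen_ball.measurableSet.prod (measurableSet_layer _ _)

omit [MeasurableSpace X] in
theorem IsGrid.exists_mem_box (hg : IsGrid k ctr l a) (hl : 0 < l) {z : X × ℝ} (hz : 0 < z.2) :
    ∃ i, z ∈ box k ctr l a i := by
  obtain ⟨j, hj⟩ := exists_mem_layer hl hz
  obtain ⟨i, rfl, hi⟩ := hg.cover j z.1
  exact ⟨i, hi, hj⟩

namespace IsRegular

theorem le_ball_layer (h : IsRegular μ n c) (x : X) {t : ℝ} {j : ℤ} (ht : t ∈ layer l j) :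
    eexp (n * l * j - c) ≤ μ (Metric.ball x t) := by
  rw [mul_assoc]
  exact (h.le_ball x _).trans (measure_mono (Metric.ball_subset_ball ht.1.le))

theorem ball_layer_le (h : IsRegular μ n c) (x : X) {t : ℝ} {j : ℤ} (ht : t ∈ layer l j) :
    μ (Metric.ball x t) ≤ eexp (n * l * j + (n * l + c)) := by
  refine (measure_mono (Metric.ball_subset_ball ht.2)).trans ((h.ball_le x _).trans (le_of_eq ?_))
  congr 1; ring

/-- On a layer V is constant up to a bounded factor, so the weight V^s is a scalar there. The sign
of s decides which volume bound gives which inequality, hence |s|. -/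
theorem enorm_volOp (h : IsRegular μ n c) (hl : 0 < l) (s : ℝ) (f : X × ℝ → ℂ) {z : X × ℝ} {j : ℤ}
    (hz : z.2 ∈ layer l j) :
    eexp (s * n * l * j - |s| * (n * l + c)) * ‖f z‖ₑ ≤ ‖volOp μ s f z‖ₑ ∧
      ‖volOp μ s f z‖ₑ ≤ eexp (s * n * l * j + |s| * (n * l + c)) * ‖f z‖ₑ := by
  have h1 := h.le_ball_layer z.1 hz
  have h2 := h.ball_layer_le z.1 hz
  have h0 : μ (Metric.ball z.1 z.2) ≠ 0 := fun h0 => by simp [h0] at h1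
  have ht : μ (Metric.ball z.1 z.2) ≠ ∞ := ne_top_of_le_ne_top (eexp_ne_top _) h2
  have hnl : 0 < n * l := mul_pos h.n_pos hl
  have hc := h.c_nonneg
  obtain ⟨v, hv⟩ := exists_eq_eexp h0 ht
  have hnorm : ‖volOp μ s f z‖ₑ = eexp (v * s) * ‖f z‖ₑ := by
    rw [volOp, enorm_mul, measureReal_def, hv, eexp, ENNReal.toReal_ofReal (Real.exp_pos _).le,
      ← Real.exp_mul, ← ofReal_norm, Complex.norm_real, Real.norm_of_nonneg
      (Real.exp_pos _).le, eexp]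
  rw [hv, eexp_le_eexp] at h1 h2
  have habs : |s * (v - n * l * j)| ≤ |s| * (n * l + c) := by
    rw [abs_mul]
    gcongr
    rw [abs_le]; constructor <;> linarith
  rw [abs_le] at habs
  rw [hnorm]
  constructor
  · gcongr
    rw [eexp_le_eexp]; linarith
  · gcongr
    rw [eexp_le_eexp]; linarith

variable [BorelSpace X]

omit [BorelSpace X] in
theorem boxNorm_rpow (hq : 0 < q) (w : ℝ) (f : X × ℝ → ℂ) (i : ι) :
    (eexp w * boxNorm μ n q k ctr l a f i) ^ q = eexp (w * q - n * l * k i) *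
      ∫⁻ z in box k ctr l a i, ‖f z‖ₑ ^ q ∂(halfSpaceMeasure μ) := by
  rw [boxNorm, ENNReal.mul_rpow_of_nonneg _ _ hq.le, ← ENNReal.rpow_mul, one_div_mul_cancel hq.ne',
    ENNReal.rpow_one, eexp_rpow, ← mul_assoc, ← eexp_add, sub_eq_add_neg]

theorem lintegral_box_le (h : IsRegular μ n c) (hl : 0 < l) (hq : 0 < q) (s : ℝ)
    (f : X × ℝ → ℂ) (i : ι) :
    ∫⁻ z in box k ctr l a i, ‖volOp μ s f z‖ₑ ^ q ∂(halfSpaceMeasure μ) ≤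
      eexp (n * l * k i + q * (|s| * (n * l + c))) *
        (eexp (s * n * l * k i) * boxNorm μ n q k ctr l a f i) ^ q := by
  rw [boxNorm_rpow hq, ← mul_assoc, ← eexp_add]
  calc _ ≤ ∫⁻ z in box k ctr l a i,
        eexp ((s * n * l * k i + |s| * (n * l + c)) * q) * ‖f z‖ₑ ^ q ∂(halfSpaceMeasure μ) := by
        refine setLIntegral_mono' (measurableSet_box i) fun z hz => ?_
        rw [← eexp_rpow, ← ENNReal.mul_rpow_of_nonneg _ _ hq.le]
        exact ENNReal.rpow_le_rpow (h.enorm_volOp hl s f hz.2).2 hq.le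
    _ = _ := by
        rw [lintegral_const_mul' _ _ (eexp_ne_top _)]
        congr 2; ring

theorem le_lintegral_box (h : IsRegular μ n c) (hl : 0 < l) (hq : 0 < q) (s : ℝ)
    (f : X × ℝ → ℂ) (i : ι) :
    (eexp (s * n * l * k i) * boxNorm μ n q k ctr l a f i) ^ q ≤
      eexp (-(n * l * k i) + q * (|s| * (n * l + c))) *
        ∫⁻ z in box k ctr l a i, ‖volOp μ s f z‖ₑ ^ q ∂(halfSpaceMeasure μ) := by
  rw [boxNorm_rpow hq]
  calc _ = eexp (-(n * l * k i) + q * (|s| * (n * l + c))) * ∫⁻ z in box k ctr l a i,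
        eexp ((s * n * l * k i - |s| * (n * l + c)) * q) * ‖f z‖ₑ ^ q ∂(halfSpaceMeasure μ) := by
        rw [lintegral_const_mul' _ _ (eexp_ne_top _), ← mul_assoc, ← eexp_add]
        congr 2; ring
    _ ≤ _ := by
        gcongr _ * ?_
        refine setLIntegral_mono' (measurableSet_box i) fun z hz => ?_
        rw [← eexp_rpow, ← ENNReal.mul_rpow_of_nonneg _ _ hq.le]
        exact ENNReal.rpow_le_rpow (h.enorm_volOp hl s f hz.2).1 hq.le

/-- The Lusin function of a function supported on the boxes of a family `J` is controlled by the
box norms over the boxes of `J` close to `x`. -/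
theorem lusin_le (h : IsRegular μ n c) [Countable ι] (hl : 0 < l) (hq : 1 ≤ q) (s : ℝ) {v : ℝ}
    (hv : Real.exp (-a) + Real.exp l ≤ Real.exp v) (f : X × ℝ → ℂ) (J : Set ι)
    (hJ : ∀ z, 0 < z.2 → f z ≠ 0 → ∃ i ∈ J, z ∈ box k ctr l a i) (x : X) :
    lusin μ q (volOp μ s f) x ≤ eexp (|s| * (n * l + c) + c / q) *
      ∑' i, ({i | dist (ctr i) x < Real.exp (l * k i + v)} ∩ J).indicator
        (fun i => eexp (s * n * l * k i) * boxNorm μ n q k ctr l a f i) i := by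
  have hq0 : 0 < q := by linarith
  set E := |s| * (n * l + c) with hE
  set M : Set ι := {i | dist (ctr i) x < Real.exp (l * k i + v)} ∩ J with hM
  set F : X × ℝ → ℝ≥0∞ := fun z => ‖volOp μ s f z‖ₑ ^ q / μ (Metric.ball z.1 z.2) with hF
  set T : Set (X × ℝ) := ⋃ i ∈ J, box k ctr l a i with hT
  have hTm : MeasurableSet T :=
    MeasurableSet.biUnion (to_countable J) fun i _ => measurableSet_box i
  have hFT : ∀ᵐ z ∂(halfSpaceMeasure μ), F z = T.indicator F z := by
    filter_upwards [ae_halfSpaceMeasure_pos μ] with z hz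
    by_cases hzT : z ∈ T
    · rw [indicator_of_mem hzT]
    · rw [indicator_of_notMem hzT]
      have : f z = 0 := by
        by_contra hne
        obtain ⟨i, hi, hzi⟩ := hJ z hz hne
        exact hzT (mem_biUnion hi hzi)
      simp [hF, volOp, this, hq0]
  -- A box that meets the cone has its centre within e^{lk}(e^{-a} + e^l) of x: box radius plus
  -- maximal height.
  have hsub : T ∩ cone x ⊆ ⋃ i : M, box k ctr l a i := by
    rintro z ⟨hzT, hzx⟩
    obtain ⟨i, hi, hzi⟩ := mem_iUnion₂.1 hzT
    refine mem_iUnion.2 ⟨⟨i, ?_, hi⟩, hzi⟩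
    change dist (ctr i) x < _
    have h1 : dist z.1 (ctr i) < Real.exp (l * k i - a) := hzi.1
    have h2 : dist z.1 x < z.2 := hzx
    have h3 : z.2 ≤ Real.exp (l * (k i + 1)) := hzi.2.2
    have h4 := dist_triangle_left (ctr i) x z.1
    rw [sub_eq_add_neg, Real.exp_add] at h1
    rw [mul_add, mul_one, Real.exp_add] at h3
    rw [Real.exp_add]
    nlinarith [Real.exp_pos (l * k i)]
  have hbox (i : ι) : ∫⁻ z in box k ctr l a i, F z ∂(halfSpaceMeasure μ) ≤
      (eexp (E + c / q) * (eexp (s * n * l * k i) * boxNorm μ n q k ctr l a f i)) ^ q := by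
    calc _ ≤ ∫⁻ z in box k ctr l a i, eexp (-(n * l * k i - c)) * ‖volOp μ s f z‖ₑ ^ q
            ∂(halfSpaceMeasure μ) := by
          refine setLIntegral_mono' (measurableSet_box i) fun z hz => ?_
          change ‖volOp μ s f z‖ₑ ^ q / μ (Metric.ball z.1 z.2) ≤ _
          rw [div_eq_mul_inv, mul_comm]
          gcongr
          rw [ENNReal.inv_le_iff_inv_le]
          refine le_trans (le_of_eq ?_) (h.le_ball_layer z.1 hz.2)
          exact (ENNReal.eq_inv_of_mul_eq_one_left (eexp_mul_neg_cancel _)).symm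
      _ ≤ eexp (-(n * l * k i - c)) * (eexp (n * l * k i + q * E) *
            (eexp (s * n * l * k i) * boxNorm μ n q k ctr l a f i) ^ q) := by
          rw [lintegral_const_mul' _ _ (eexp_ne_top _)]
          gcongr
          exact h.lintegral_box_le hl hq0 s f i
      _ = _ := by
          rw [ENNReal.mul_rpow_of_nonneg (eexp (E + c / q)) _ hq0.le, ← mul_assoc, ← eexp_add,
            eexp_rpow]
          congr 2; field_simp; ring
  have hint : ∫⁻ z in cone x, F z ∂(halfSpaceMeasure μ) ≤
      (eexp (E + c / q) * ∑' i, M.indicator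
        (fun i => eexp (s * n * l * k i) * boxNorm μ n q k ctr l a f i) i) ^ q := by
    calc _ = ∫⁻ z in T ∩ cone x, F z ∂(halfSpaceMeasure μ) := by
          rw [lintegral_congr_ae (ae_restrict_of_ae hFT), setLIntegral_indicator hTm]
      _ ≤ ∑' i : M, ∫⁻ z in box k ctr l a i, F z ∂(halfSpaceMeasure μ) :=
          (lintegral_mono_set hsub).trans (lintegral_iUnion_le _ _)
      _ ≤ ∑' i : M, (eexp (E + c / q) *
            (eexp (s * n * l * k i) * boxNorm μ n q k ctr l a f i)) ^ q :=
          ENNReal.tsum_le_tsum fun i => hbox i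
      -- Passing from ℓ^q to ℓ^1 loses nothing in the end, because `tsum_rpow_le_iSup` later bounds
      -- the ℓ^1 sum by a supremum.
      _ ≤ (∑' i : M, (eexp (E + c / q) *
            (eexp (s * n * l * k i) * boxNorm μ n q k ctr l a f i))) ^ q :=
          tsum_rpow_le_rpow_tsum hq _
      _ = _ := by
          rw [ENNReal.tsum_mul_left, tsum_subtype M
            fun i => eexp (s * n * l * k i) * boxNorm μ n q k ctr l a f i]
  rw [lusin, one_div, ENNReal.rpow_inv_le_iff hq0]
  exact hint

/-- A box norm is controlled by the Lusin function on the base of the box. -/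
theorem le_lusin (h : IsRegular μ n c) (hl : 0 < l) (hq : 0 < q) (s : ℝ)
    (ha : 2 * Real.exp (-a) ≤ 1) (f : X × ℝ → ℂ) {i : ι} {x : X}
    (hx : x ∈ Metric.ball (ctr i) (Real.exp (l * k i - a))) :
    eexp (s * n * l * k i) * boxNorm μ n q k ctr l a f i ≤
      eexp (|s| * (n * l + c) + (n * l + c) / q) * lusin μ q (volOp μ s f) x := by
  set E := |s| * (n * l + c) with hE
  -- Two points of the base are less than 2e^{lk-a} ≤ e^{lk} apart, and all heights in the box
  -- exceed e^{lk}.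
  have hsub : box k ctr l a i ⊆ cone x := by
    intro z hz
    have h1 : dist z.1 (ctr i) < Real.exp (l * k i - a) := hz.1
    have h2 : dist x (ctr i) < Real.exp (l * k i - a) := hx
    have h3 : Real.exp (l * k i) < z.2 := hz.2.1
    have h4 := dist_triangle_right z.1 x (ctr i)
    rw [sub_eq_add_neg, Real.exp_add] at h1 h2
    change dist z.1 x < z.2
    nlinarith [Real.exp_pos (l * k i)]
  rw [← ENNReal.rpow_le_rpow_iff hq]
  refine (h.le_lintegral_box hl hq s f i).trans ?_
  rw [ENNReal.mul_rpow_of_nonneg _ _ hq.le, lusin, ← ENNReal.rpow_mul, one_div_mul_cancel hq.ne',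
    ENNReal.rpow_one]
  calc _ = eexp (n * l + c + q * E) * ∫⁻ z in box k ctr l a i,
        eexp (-(n * l * k i + (n * l + c))) * ‖volOp μ s f z‖ₑ ^ q ∂(halfSpaceMeasure μ) := by
        rw [lintegral_const_mul' _ _ (eexp_ne_top _), ← mul_assoc (eexp (n * l + c + q * E)),
          ← eexp_add]
        congr 2; ring
    _ ≤ eexp (n * l + c + q * E) * ∫⁻ z in box k ctr l a i,
        ‖volOp μ s f z‖ₑ ^ q / μ (Metric.ball z.1 z.2) ∂(halfSpaceMeasure μ) := by
        gcongr _ * ?_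
        refine setLIntegral_mono' (measurableSet_box i) fun z hz => ?_
        rw [div_eq_mul_inv, mul_comm]
        gcongr
        rw [ENNReal.le_inv_iff_le_inv]
        refine (h.ball_layer_le z.1 hz.2).trans (le_of_eq ?_)
        exact ENNReal.eq_inv_of_mul_eq_one_left (eexp_mul_neg_cancel _)
    _ ≤ eexp (n * l + c + q * E) * ∫⁻ z in cone x,
        ‖volOp μ s f z‖ₑ ^ q / μ (Metric.ball z.1 z.2) ∂(halfSpaceMeasure μ) := by
        gcongr
    _ = _ := by
        rw [eexp_rpow]
        congr 2; field_simp; ring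

end IsRegular

end Boxes

/-! ### Bounded overlap, and Whitney averages against box norms -/

/-- Bounded overlap. No measurability of `G` is required: on each set it is replaced by a measurable
minorant with the same integral. -/
theorem tsum_setLIntegral_le {α ι : Type*} [MeasurableSpace α] [Countable ι] {ν : Measure α}
    {S : ι → Set α} (hS : ∀ i, MeasurableSet (S i)) {N : ℝ≥0∞} (hNt : N ≠ ∞)
    (hN : ∀ z, ∑' i, (S i).indicator 1 z ≤ N) (G : α → ℝ≥0∞) :
    ∑' i, ∫⁻ z in S i, G z ∂ν ≤ N * ∫⁻ z, G z ∂ν := by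
  choose g hgm hg hgi using fun i => exists_measurable_le_lintegral_eq (μ := ν.restrict (S i)) G
  calc _ = ∑' i, ∫⁻ z, (S i).indicator (g i) z ∂ν := by
        refine tsum_congr fun i => ?_
        rw [hgi i, lintegral_indicator (hS i)]
    _ = ∫⁻ z, ∑' i, (S i).indicator (g i) z ∂ν :=
        (lintegral_tsum fun i => ((hgm i).indicator (hS i)).aemeasurable).symm
    _ ≤ ∫⁻ z, N * G z ∂ν := by
        refine lintegral_mono fun z => ?_
        calc _ ≤ ∑' i, (S i).indicator 1 z * G z := by
              refine ENNReal.tsum_le_tsum fun i => ?_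
              by_cases hz : z ∈ S i
              · simpa [hz] using hg i z
              · simp [hz]
          _ ≤ _ := by rw [ENNReal.tsum_mul_right]; gcongr; exact hN z
    _ = _ := lintegral_const_mul' _ _ hNt

theorem tsum_indicator_rpow_le {ι : Type*} {M : Set ι} {N : ℝ≥0∞} {p : ℝ} (hp : 0 < p)
    (hN : ∑' i, M.indicator (1 : ι → ℝ≥0∞) i ≤ N) (f : ι → ℝ≥0∞) :
    (∑' i, M.indicator f i) ^ p ≤ N ^ p * ∑' i, M.indicator (fun i => f i ^ p) i := by
  set S := ∑' i, M.indicator (fun i => f i ^ p) i with hS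
  have h1 (i : ι) (hi : i ∈ M) : f i ≤ S ^ (1 / p) := by
    rw [one_div, ENNReal.le_rpow_inv_iff hp]
    refine le_trans ?_ (ENNReal.le_tsum i)
    simp [hi]
  calc _ ≤ (∑' i, M.indicator (1 : ι → ℝ≥0∞) i * S ^ (1 / p)) ^ p := by
        gcongr with i
        by_cases hi : i ∈ M
        · simpa [hi] using h1 i hi
        · simp [hi]
    _ ≤ (N * S ^ (1 / p)) ^ p := by
        rw [ENNReal.tsum_mul_right]; gcongr
    _ = _ := by
        rw [ENNReal.mul_rpow_of_nonneg _ _ hp.le, ← ENNReal.rpow_mul, one_div_mul_cancel hp.ne',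
          ENNReal.rpow_one]

section Layers

variable {l : ℝ}

/-- A layer together with its two neighbours. -/
def wideLayer (l : ℝ) (k : ℤ) : Set ℝ := Ioc (Real.exp (l * (k - 1))) (Real.exp (l * (k + 2)))

theorem tsum_wideLayer_le (hl : 0 < l) (t : ℝ) :
    ∑' j, (wideLayer l j).indicator (1 : ℝ → ℝ≥0∞) t ≤ 3 := by
  have hone : ∑' j, (layer l j).indicator (1 : ℝ → ℝ≥0∞) t ≤ 1 := by
    rcases em (∃ j, t ∈ layer l j) with ⟨j, hj⟩ | hno
    · rw [tsum_eq_single j]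
      · exact indicator_le_self' (fun _ _ => zero_le) t
      · intro i hi
        exact indicator_of_notMem (fun hti => Set.disjoint_left.1 (layer_disjoint hl hi) hti hj) _
    · push Not at hno
      simp [hno]
  have hshift (e : ℤ) : ∑' j, (layer l (j + e)).indicator (1 : ℝ → ℝ≥0∞) t ≤ 1 := by
    rwa [← (Equiv.addRight e).tsum_eq fun j => (layer l j).indicator (1 : ℝ → ℝ≥0∞) t] at hone
  calc _ ≤ ∑' j, ((layer l (j + -1)).indicator (1 : ℝ → ℝ≥0∞) t +
        (layer l (j + 0)).indicator (1 : ℝ → ℝ≥0∞) t +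
        (layer l (j + 1)).indicator (1 : ℝ → ℝ≥0∞) t) := by
        refine ENNReal.tsum_le_tsum fun j => ?_
        by_cases ht : t ∈ wideLayer l j
        · rw [indicator_of_mem ht]
          rcases le_or_gt t (Real.exp (l * j)) with h1 | h1
          · have : t ∈ layer l (j + -1) := by
              refine ⟨?_, ?_⟩ <;> push_cast
              · exact ht.1
              · simpa using h1
            simp [indicator_of_mem this, add_assoc]
          rcases le_or_gt t (Real.exp (l * (j + 1))) with h2 | h2
          · have : t ∈ layer l (j + 0) := by
              rw [add_zero]; exact ⟨h1, h2⟩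
            rw [indicator_of_mem this]
            exact le_add_right le_add_self
          · have : t ∈ layer l (j + 1) := by
              refine ⟨?_, ?_⟩ <;> push_cast
              · exact h2
              · have := ht.2; rwa [add_assoc, one_add_one_eq_two]
            simp [indicator_of_mem this]
        · simp [ht]
    _ ≤ 1 + 1 + 1 := by
        rw [ENNReal.tsum_add, ENNReal.tsum_add]
        exact add_le_add (add_le_add (hshift _) (hshift _)) (hshift _)
    _ = 3 := by norm_num

end Layers

section Whitney

variable {X : Type*} [MetricSpace X] [MeasurableSpace X] [BorelSpace X] {μ : Measure X} {n c : ℝ}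
  {ι : Type*} {k : ι → ℤ} {ctr : ι → X} {l a : ℝ} {p q s c₀ : ℝ}

namespace IsRegular

omit [BorelSpace X] in
-- The region has measure about t^{n+1}: t^n from the ball and t from the interval, whose length is
-- (c₁ - c₁⁻¹)t with c₁ = e^l.
theorem whitneyRegion_measure (h : IsRegular μ n c) (hl : 0 < l) (hc₀ : 0 < c₀) :
    ∃ d : ℝ, ∀ (z : X × ℝ) (j : ℤ), z.2 ∈ layer l j →
      eexp ((n + 1) * l * j - d) ≤ μ.prod volume (whitneyRegion c₀ (Real.exp l) z) ∧
      μ.prod volume (whitneyRegion c₀ (Real.exp l) z) ≤ eexp ((n + 1) * l * j + d) := by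
  have := h.sigmaFinite
  have hg : 0 < Real.exp l - (Real.exp l)⁻¹ := by
    rw [← Real.exp_neg, sub_pos, Real.exp_lt_exp]; linarith
  set γ := Real.log (Real.exp l - (Real.exp l)⁻¹) with hγ
  have hn := h.n_pos
  have hcc := h.c_nonneg
  refine ⟨|γ| + n * |Real.log c₀| + c + (n + 1) * l, fun z j hz => ?_⟩
  have ht : 0 < z.2 := (Real.exp_pos _).trans hz.1
  set τ := Real.log z.2 with hτ
  have h1 : l * j ≤ τ := (Real.lt_log_iff_exp_lt ht).2 hz.1 |>.le
  have h2 : τ ≤ l * (j + 1) := (Real.log_le_iff_le_exp ht).2 hz.2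
  have hvol : volume (Ioo ((Real.exp l)⁻¹ * z.2) (Real.exp l * z.2)) = eexp (γ + τ) := by
    rw [Real.volume_Ioo, eexp, Real.exp_add, hγ, hτ, Real.exp_log hg, Real.exp_log ht]
    congr 1; ring
  have hrad : c₀ * z.2 = Real.exp (Real.log c₀ + τ) := by
    rw [Real.exp_add, Real.exp_log hc₀, hτ, Real.exp_log ht]
  rw [whitneyRegion, Measure.prod_prod, hvol, hrad]
  have h3 := neg_abs_le γ
  have h4 := le_abs_self γ
  have h5 := mul_le_mul_of_nonneg_left (neg_abs_le (Real.log c₀)) hn.le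
  have h6 := mul_le_mul_of_nonneg_left (le_abs_self (Real.log c₀)) hn.le
  have h7 := mul_le_mul_of_nonneg_left h1 hn.le
  have h8 := mul_le_mul_of_nonneg_left h2 hn.le
  have h9 : 0 < n * l := mul_pos hn hl
  constructor
  · refine le_trans ?_ (mul_le_mul_left (h.le_ball _ _) _)
    rw [← eexp_add, eexp_le_eexp]
    linarith
  · refine (mul_le_mul_left (h.ball_le _ _) _).trans ?_
    rw [← eexp_add, eexp_le_eexp]
    linarith

omit [BorelSpace X] in
theorem restrict_box_le (h : IsRegular μ n c) (i : ι) :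
    (halfSpaceMeasure μ).restrict (box k ctr l a i) ≤
      eexp (-(l * k i)) • (μ.prod volume).restrict (box k ctr l a i) := by
  have := h.sigmaFinite
  rw [box, halfSpaceMeasure, ← Measure.prod_restrict, ← Measure.prod_restrict,
    ← Measure.prod_smul_right]
  refine Measure.prod_mono le_rfl ?_
  rw [eexp, Real.exp_neg]
  exact haarPos_restrict_Ioc_le (Real.exp_pos _)

omit [BorelSpace X] in
theorem le_restrict_box (h : IsRegular μ n c) (i : ι) :
    eexp (-(l * (k i + 1))) • (μ.prod volume).restrict (box k ctr l a i) ≤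
      (halfSpaceMeasure μ).restrict (box k ctr l a i) := by
  have := h.sigmaFinite
  rw [box, halfSpaceMeasure, ← Measure.prod_restrict, ← Measure.prod_restrict,
    ← Measure.prod_smul_right]
  refine Measure.prod_mono le_rfl ?_
  rw [eexp, Real.exp_neg]
  exact le_haarPos_restrict_Ioc (Real.exp_pos _)

omit [BorelSpace X] in
theorem whitneyAverage_rpow (hq : 0 < q) (f : X × ℝ → ℂ) (c₁ : ℝ) (z : X × ℝ) :
    whitneyAverage μ q c₀ c₁ f z ^ q = (∫⁻ w in whitneyRegion c₀ c₁ z, ‖f w‖ₑ ^ q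
      ∂(μ.prod volume)) / μ.prod volume (whitneyRegion c₀ c₁ z) := by
  rw [whitneyAverage, ← ENNReal.rpow_mul, one_div_mul_cancel hq.ne', ENNReal.rpow_one,
    setLAverage_eq]

/-- A box lies in the Whitney region of each of its points: 2e^{-a} ≤ c₀ controls the base, and
heights in a half-open layer have ratio strictly below e^l = c₁. -/
theorem boxNorm_le_whitneyAverage (h : IsRegular μ n c) (hl : 0 < l) (hq : 0 < q) (s : ℝ)
    (hc₀ : 0 < c₀) (ha : 2 * Real.exp (-a) ≤ c₀) :
    ∃ C : ℝ≥0∞, C ≠ ∞ ∧ ∀ (f : X × ℝ → ℂ) (i : ι) (z : X × ℝ), z ∈ box k ctr l a i →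
      eexp (s * n * l * k i) * boxNorm μ n q k ctr l a f i ≤
        C * whitneyAverage μ q c₀ (Real.exp l) (volOp μ s f) z := by
  obtain ⟨d, hd⟩ := h.whitneyRegion_measure hl hc₀
  set E := |s| * (n * l + c) with hE
  refine ⟨eexp (E + d / q), eexp_ne_top _, fun f i z hz => ?_⟩
  have hsub : box k ctr l a i ⊆ whitneyRegion c₀ (Real.exp l) z := by
    intro w hw
    have h1 : dist w.1 (ctr i) < Real.exp (l * k i - a) := hw.1
    have h2 : dist z.1 (ctr i) < Real.exp (l * k i - a) := hz.1
    have h3 : Real.exp (l * k i) < z.2 := hz.2.1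
    have h4 : Real.exp (l * k i) < w.2 := hw.2.1
    have h5 : z.2 ≤ Real.exp (l * (k i + 1)) := hz.2.2
    have h6 : w.2 ≤ Real.exp (l * (k i + 1)) := hw.2.2
    have h7 := dist_triangle_right w.1 z.1 (ctr i)
    rw [sub_eq_add_neg, Real.exp_add] at h1 h2
    rw [mul_add, mul_one, Real.exp_add] at h5 h6
    have h8 := Real.exp_pos (l * k i)
    have h9 := Real.exp_pos l
    refine ⟨?_, ?_, ?_⟩
    · change dist w.1 z.1 < c₀ * z.2
      nlinarith
    · rw [inv_mul_lt_iff₀ h9]; nlinarith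
    · nlinarith
  obtain ⟨hd1, hd2⟩ := hd z (k i) hz.2
  set Ω := μ.prod volume (whitneyRegion c₀ (Real.exp l) z) with hΩ
  have hΩ0 : Ω ≠ 0 := fun h0 => by simp [h0] at hd1
  have hΩt : Ω ≠ ∞ := ne_top_of_le_ne_top (eexp_ne_top _) hd2
  rw [← ENNReal.rpow_le_rpow_iff hq, ENNReal.mul_rpow_of_nonneg (eexp (E + d / q)) _ hq.le,
    whitneyAverage_rpow hq]
  set I := ∫⁻ w in whitneyRegion c₀ (Real.exp l) z, ‖volOp μ s f w‖ₑ ^ q ∂(μ.prod volume) with hI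
  refine (h.le_lintegral_box hl hq s f i).trans ?_
  calc _ ≤ eexp (-(n * l * k i) + q * E) * (eexp (-(l * k i)) *
        ∫⁻ w in box k ctr l a i, ‖volOp μ s f w‖ₑ ^ q ∂(μ.prod volume)) := by
        gcongr _ * ?_
        refine (lintegral_mono' (h.restrict_box_le i) le_rfl).trans ?_
        rw [lintegral_smul_measure, smul_eq_mul]
    _ ≤ eexp (-(n * l * k i) + q * E) * (eexp (-(l * k i)) * I) := by
        gcongr _ * (_ * ?_)
        exact lintegral_mono_set hsub
    _ = eexp (-(n * l * k i) + q * E) * (eexp (-(l * k i)) * (I / Ω * Ω)) := by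
        rw [ENNReal.div_mul_cancel hΩ0 hΩt]
    _ ≤ eexp (-(n * l * k i) + q * E) *
          (eexp (-(l * k i)) * (I / Ω * eexp ((n + 1) * l * k i + d))) := by gcongr
    _ = eexp (-(n * l * k i) + q * E) * eexp (-(l * k i)) * eexp ((n + 1) * l * k i + d) *
          (I / Ω) := by ring
    _ = _ := by
        rw [← eexp_add, ← eexp_add, eexp_rpow]
        congr 2; field_simp; ring

/-- The discrete norm is controlled by the norm of the Whitney averages. -/
theorem tsum_boxNorm_le_lintegral_whitney (h : IsRegular μ n c) [Countable ι]
    (hg : IsGrid k ctr l a) (hl : 0 < l) (hp : 0 < p) (hq : 0 < q) (s : ℝ)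
    (hc₀ : 0 < c₀) (ha : 2 * Real.exp (-a) ≤ c₀) :
    ∃ C : ℝ≥0∞, C ≠ ∞ ∧ ∀ f : X × ℝ → ℂ,
      ∑' i, eexp (n * l * k i) * (eexp (s * n * l * k i) * boxNorm μ n q k ctr l a f i) ^ p ≤
        C * ∫⁻ z, whitneyAverage μ q c₀ (Real.exp l) (volOp μ s f) z ^ p
          ∂(halfSpaceMeasure μ) := by
  have := h.sigmaFinite
  obtain ⟨C, hC, hpt⟩ := h.boxNorm_le_whitneyAverage (k := k) (ctr := ctr) hl hq s hc₀ ha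
  obtain ⟨N, hN, hcount⟩ := hg.count (-a)
  set δ := ENNReal.ofReal (1 - Real.exp (-l)) with hδ
  have hδ0 : δ ≠ 0 := by simp [hδ, hl]
  have hover (z : X × ℝ) : ∑' i, (box k ctr l a i).indicator (1 : X × ℝ → ℝ≥0∞) z ≤ N := by
    rcases em (∃ j, z.2 ∈ layer l j) with ⟨j, hj⟩ | hno
    · refine le_trans (ENNReal.tsum_le_tsum fun i => ?_) (hcount z.1 j)
      by_cases hz : z ∈ box k ctr l a i
      · have hk : k i = j := by
          by_contra hne
          exact Set.disjoint_left.1 (layer_disjoint hl hne) hz.2 hj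
        have hd : dist (ctr i) z.1 < Real.exp (l * k i + -a) := by
          rw [dist_comm]; exact hz.1
        rw [indicator_of_mem hz, indicator_of_mem (show i ∈ _ ∩ _ from ⟨hd, hk⟩)]
        rfl
      · simp [hz]
    · push Not at hno
      have : ∀ i, z ∉ box k ctr l a i := fun i hz => hno _ hz.2
      simp [this]
  -- Up to constants the weight e^{nlk} of the discrete norm is at most the mass of the box.
  have hbox (i : ι) : eexp (n * l * k i) * δ ≤
      eexp (n * a + c) * halfSpaceMeasure μ (box k ctr l a i) := by
    rw [box, halfSpaceMeasure, Measure.prod_prod, ← mul_assoc]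
    gcongr
    · calc _ = eexp (n * a + c) * eexp (n * (l * k i - a) - c) := by
            rw [← eexp_add]; congr 1; ring
        _ ≤ _ := by gcongr; exact h.le_ball _ _
    · exact le_haarPos_layer l (k i)
  refine ⟨δ⁻¹ * eexp (n * a + c) * C ^ p * N, by
    refine ENNReal.mul_ne_top (ENNReal.mul_ne_top (ENNReal.mul_ne_top ?_ ?_) ?_) hN
    · exact ENNReal.inv_ne_top.2 hδ0
    · exact eexp_ne_top _
    · exact ENNReal.rpow_ne_top_of_nonneg hp.le hC, fun f => ?_⟩
  set W := fun z => whitneyAverage μ q c₀ (Real.exp l) (volOp μ s f) z ^ p with hW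
  calc _ ≤ ∑' i, δ⁻¹ * eexp (n * a + c) * C ^ p *
        ∫⁻ z in box k ctr l a i, W z ∂(halfSpaceMeasure μ) := by
        refine ENNReal.tsum_le_tsum fun i => ?_
        set b := (eexp (s * n * l * k i) * boxNorm μ n q k ctr l a f i) ^ p with hb
        calc eexp (n * l * k i) * b = δ⁻¹ * (eexp (n * l * k i) * δ) * b := by
              rw [mul_left_comm, ENNReal.inv_mul_cancel hδ0 ENNReal.ofReal_ne_top, mul_one]
          _ ≤ δ⁻¹ * (eexp (n * a + c) * halfSpaceMeasure μ (box k ctr l a i)) * b := by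
              gcongr _ * ?_ * _; exact hbox i
          _ = δ⁻¹ * eexp (n * a + c) * ∫⁻ z in box k ctr l a i, b ∂(halfSpaceMeasure μ) := by
              rw [setLIntegral_const]; ring
          _ ≤ δ⁻¹ * eexp (n * a + c) * ∫⁻ z in box k ctr l a i, C ^ p * W z
                ∂(halfSpaceMeasure μ) := by
              gcongr _ * ?_
              refine setLIntegral_mono' (measurableSet_box i) fun z hz => ?_
              rw [hW, ← ENNReal.mul_rpow_of_nonneg _ _ hp.le]
              exact ENNReal.rpow_le_rpow (hpt f i z hz) hp.le
          _ = _ := by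
              rw [lintegral_const_mul' _ _ (ENNReal.rpow_ne_top_of_nonneg hp.le hC)]; ring
    _ ≤ δ⁻¹ * eexp (n * a + c) * C ^ p * (N * ∫⁻ z, W z ∂(halfSpaceMeasure μ)) := by
        rw [ENNReal.tsum_mul_left]
        gcongr
        exact tsum_setLIntegral_le (fun i => measurableSet_box i) hN hover W
    _ = _ := by ring

/-- The norm of the Whitney averages is controlled by the discrete norm. -/
theorem lintegral_whitney_le_tsum_boxNorm (h : IsRegular μ n c) [Countable ι]
    (hg : IsGrid k ctr l a) (hl : 0 < l) (hp : 0 < p) (hq : 1 ≤ q) (s : ℝ) (hc₀ : 0 < c₀) :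
    ∃ C : ℝ≥0∞, C ≠ ∞ ∧ ∀ f : X × ℝ → ℂ,
      ∫⁻ z, whitneyAverage μ q c₀ (Real.exp l) (volOp μ s f) z ^ p ∂(halfSpaceMeasure μ) ≤
      C * ∑' i, eexp (n * l * k i) *
        (eexp (s * n * l * k i) * boxNorm μ n q k ctr l a f i) ^ p := by
  have := h.sigmaFinite
  have hq0 : 0 < q := by linarith
  obtain ⟨d, hd⟩ := h.whitneyRegion_measure hl hc₀
  set v := Real.log (Real.exp (-a) + c₀ * Real.exp (2 * l)) with hv
  have hve : Real.exp v = Real.exp (-a) + c₀ * Real.exp (2 * l) := Real.exp_log (by positivity)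
  obtain ⟨N, hN, hcount⟩ := hg.count v
  set E := |s| * (n * l + c) with hE
  -- The term l comes from dt against dt/t, q E from the weight V^s, d from the measure of the
  -- region, and 2(n+1)l from k ≤ j + 2 for boxes meeting a region whose centre has height in layer
  -- j.
  set e := (l + q * E + 2 * ((n + 1) * l) + d) / q with he
  -- The enlarged box contains every z whose Whitney region meets box i: heights differ by a factor
  -- less than e^l, so neighbouring layers suffice, and v accounts for the box radius plus c₀ times
  -- the height of z.
  set T : ι → Set (X × ℝ) := fun i =>
    Metric.ball (ctr i) (Real.exp (l * k i + v)) ×ˢ wideLayer l (k i) with hT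
  have hTm (i : ι) : MeasurableSet (T i) :=
    Metric.isOpen_ball.measurableSet.prod measurableSet_Ioc
  set M : X × ℝ → Set ι := fun z => {i | z ∈ T i} with hM
  have hMcount (z : X × ℝ) : ∑' i, (M z).indicator (1 : ι → ℝ≥0∞) i ≤ N * 3 := by
    have hlev : ∀ j, ∑' i, (M z ∩ k ⁻¹' {j}).indicator (1 : ι → ℝ≥0∞) i ≤ N :=
      level_mono (fun i (hi : z ∈ T i) => by
        change dist (ctr i) z.1 < _; rw [dist_comm]; exact hi.1) (hcount z.1)
    refine (tsum_indicator_level_le hlev (h := fun j => (wideLayer l j).indicator 1 z.2)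
      fun i (hi : z ∈ T i) => ?_).trans ?_
    · rw [indicator_of_mem hi.2]; rfl
    · gcongr; exact tsum_wideLayer_le hl z.2
  have hpt (f : X × ℝ → ℂ) (z : X × ℝ) (hz : 0 < z.2) :
      whitneyAverage μ q c₀ (Real.exp l) (volOp μ s f) z ≤ ∑' i, (M z).indicator
        (fun i => eexp e * (eexp (s * n * l * k i) * boxNorm μ n q k ctr l a f i)) i := by
    obtain ⟨j, hj⟩ := exists_mem_layer hl hz
    have hd1 := (hd z j hj).1
    have hsub : whitneyRegion c₀ (Real.exp l) z ⊆ ⋃ i : M z, box k ctr l a i := by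
      intro w hw
      have h9 := Real.exp_pos l
      have h1 : dist w.1 z.1 < c₀ * z.2 := hw.1
      have h2 : (Real.exp l)⁻¹ * z.2 < w.2 := hw.2.1
      have h3 : w.2 < Real.exp l * z.2 := hw.2.2
      have hw0 : 0 < w.2 := lt_trans (by positivity) h2
      obtain ⟨i, hi⟩ := hg.exists_mem_box hl hw0
      refine mem_iUnion.2 ⟨⟨i, ?_⟩, hi⟩
      have h4 : dist w.1 (ctr i) < Real.exp (l * k i - a) := hi.1
      have h5 : Real.exp (l * k i) < w.2 := hi.2.1
      have h6 : w.2 ≤ Real.exp (l * (k i + 1)) := hi.2.2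
      rw [inv_mul_lt_iff₀ h9] at h2
      have h7 : z.2 < Real.exp (l * (k i + 2)) := by
        rw [show l * ((k i : ℝ) + 2) = l + l * (k i + 1) by ring, Real.exp_add]
        nlinarith
      refine ⟨?_, ?_, h7.le⟩
      · have h8 := dist_triangle_left z.1 (ctr i) w.1
        rw [sub_eq_add_neg, Real.exp_add] at h4
        rw [mul_add, Real.exp_add, mul_comm l 2] at h7
        change dist z.1 (ctr i) < Real.exp (l * k i + v)
        rw [Real.exp_add, hve]
        nlinarith
      · have : l * (k i : ℝ) = l + l * (k i - 1) := by ring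
        rw [this, Real.exp_add] at h5
        exact lt_of_mul_lt_mul_left (h5.trans h3) h9.le
    have hboxle (i : ι) (hi : i ∈ M z) :
        (∫⁻ w in box k ctr l a i, ‖volOp μ s f w‖ₑ ^ q ∂(μ.prod volume)) /
          μ.prod volume (whitneyRegion c₀ (Real.exp l) z) ≤
        (eexp e * (eexp (s * n * l * k i) * boxNorm μ n q k ctr l a f i)) ^ q := by
      have hkj : (k i : ℝ) ≤ j + 2 := by
        have h1 : Real.exp (l * (k i - 1)) < z.2 := hi.2.1
        have h2 := Real.exp_lt_exp.1 (h1.trans_le hj.2)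
        have := lt_of_mul_lt_mul_left h2 hl.le
        linarith
      have hnl : 0 < (n + 1) * l := mul_pos (by linarith [h.n_pos]) hl
      calc _ ≤ (eexp (l * (k i + 1)) *
            ∫⁻ w in box k ctr l a i, ‖volOp μ s f w‖ₑ ^ q ∂(halfSpaceMeasure μ)) /
              eexp ((n + 1) * l * j - d) := by
            gcongr
            calc _ = eexp (l * (k i + 1)) * (eexp (-(l * (k i + 1))) *
                ∫⁻ w in box k ctr l a i, ‖volOp μ s f w‖ₑ ^ q ∂(μ.prod volume)) := by
                  rw [← mul_assoc, eexp_mul_neg_cancel, one_mul]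
              _ ≤ _ := by
                  rw [← smul_eq_mul (eexp (-(l * (k i + 1)))), ← lintegral_smul_measure]
                  gcongr _ * ?_
                  exact lintegral_mono' (h.le_restrict_box i) le_rfl
        _ ≤ (eexp (l * (k i + 1)) * (eexp (n * l * k i + q * E) *
              (eexp (s * n * l * k i) * boxNorm μ n q k ctr l a f i) ^ q)) /
              eexp ((n + 1) * l * j - d) := by
            gcongr
            exact h.lintegral_box_le hl hq0 s f i
        _ = eexp (l * (k i + 1) + (n * l * k i + q * E) + -((n + 1) * l * j - d)) *
              (eexp (s * n * l * k i) * boxNorm μ n q k ctr l a f i) ^ q := by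
            rw [div_eq_mul_inv,
              ← ENNReal.eq_inv_of_mul_eq_one_left (eexp_neg_mul_cancel ((n + 1) * l * j - d)),
              eexp_add (l * (k i + 1) + (n * l * k i + q * E)),
              eexp_add (l * ((k i : ℝ) + 1)), mul_right_comm, mul_assoc (eexp (l * (k i + 1)))]
            ring
        _ ≤ eexp (e * q) * (eexp (s * n * l * k i) * boxNorm μ n q k ctr l a f i) ^ q := by
            gcongr
            rw [eexp_le_eexp, he, div_mul_cancel₀ _ hq0.ne']
            nlinarith
        _ = _ := by rw [ENNReal.mul_rpow_of_nonneg (eexp e) _ hq0.le, eexp_rpow]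
    rw [← ENNReal.rpow_le_rpow_iff hq0, whitneyAverage_rpow hq0,
      ← tsum_subtype (M z) fun i => eexp e * (eexp (s * n * l * k i) * boxNorm μ n q k ctr l a f i)]
    calc _ ≤ (∑' i : M z, ∫⁻ w in box k ctr l a i, ‖volOp μ s f w‖ₑ ^ q ∂(μ.prod volume)) /
          μ.prod volume (whitneyRegion c₀ (Real.exp l) z) := by
          gcongr
          exact (lintegral_mono_set hsub).trans (lintegral_iUnion_le _ _)
      _ = ∑' i : M z, (∫⁻ w in box k ctr l a i, ‖volOp μ s f w‖ₑ ^ q ∂(μ.prod volume)) /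
          μ.prod volume (whitneyRegion c₀ (Real.exp l) z) := by
          simp only [div_eq_mul_inv, ENNReal.tsum_mul_right]
      _ ≤ ∑' i : M z, (eexp e * (eexp (s * n * l * k i) * boxNorm μ n q k ctr l a f i)) ^ q :=
          ENNReal.tsum_le_tsum fun i => hboxle i i.2
      _ ≤ _ := tsum_rpow_le_rpow_tsum hq _
  set D := eexp (n * v + c) * ENNReal.ofReal (Real.exp (3 * l) - 1) with hD
  have hTmeas (i : ι) : halfSpaceMeasure μ (T i) ≤ eexp (n * l * k i) * D := by
    rw [hT, halfSpaceMeasure, Measure.prod_prod, hD, ← mul_assoc, ← eexp_add]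
    gcongr
    · refine (h.ball_le _ _).trans (le_of_eq ?_)
      congr 1; ring
    · refine (haarPos_Ioc_le (Real.exp_pos _)).trans (ENNReal.ofReal_le_ofReal (le_of_eq ?_))
      rw [show l * ((k i : ℝ) + 2) = l * (k i - 1) + 3 * l by ring, Real.exp_add]
      field_simp
  refine ⟨(N * 3) ^ p * eexp (e * p) * D, ?_, fun f => ?_⟩
  · refine ENNReal.mul_ne_top (ENNReal.mul_ne_top (ENNReal.rpow_ne_top_of_nonneg hp.le
      (ENNReal.mul_ne_top hN (by simp))) (eexp_ne_top _))
      (ENNReal.mul_ne_top (eexp_ne_top _) ENNReal.ofReal_ne_top)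
  set b := fun i => eexp (s * n * l * k i) * boxNorm μ n q k ctr l a f i with hb
  calc _ ≤ ∫⁻ z, (N * 3) ^ p * ∑' i, (T i).indicator (fun _ => (eexp e * b i) ^ p) z
        ∂(halfSpaceMeasure μ) := by
        refine lintegral_mono_ae ?_
        filter_upwards [ae_halfSpaceMeasure_pos μ] with z hz
        refine (ENNReal.rpow_le_rpow (hpt f z hz) hp.le).trans ?_
        refine (tsum_indicator_rpow_le hp (hMcount z) _).trans (le_of_eq ?_)
        rfl
    _ = (N * 3) ^ p * ∑' i, (eexp e * b i) ^ p * halfSpaceMeasure μ (T i) := by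
        rw [lintegral_const_mul' _ _ (ENNReal.rpow_ne_top_of_nonneg hp.le
          (ENNReal.mul_ne_top hN (by simp))), lintegral_tsum
          fun i => (measurable_const.indicator (hTm i)).aemeasurable]
        congr 1
        exact tsum_congr fun i => lintegral_indicator_const (hTm i) _
    _ ≤ (N * 3) ^ p * ∑' i, (eexp e * b i) ^ p * (eexp (n * l * k i) * D) := by
        gcongr with i
        exact hTmeas i
    _ = _ := by
        rw [← ENNReal.tsum_mul_left, ← ENNReal.tsum_mul_left]
        refine tsum_congr fun i => ?_
        rw [ENNReal.mul_rpow_of_nonneg (eexp e) _ hp.le, eexp_rpow]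
        ring

end IsRegular

end Whitney

/-! ### The interpolation norm equals the discrete norm up to constants -/

section Equivalence

variable {X : Type*} [MetricSpace X] [MeasurableSpace X] [BorelSpace X] {μ : Measure X} {n c : ℝ}
  {ι : Type*} {k : ι → ℤ} {ctr : ι → X} {l a : ℝ} {p₀ p₁ θ p η q s : ℝ}

omit [BorelSpace X] in
theorem lusin_congr_ae {f g : X × ℝ → ℂ} (h : f =ᵐ[halfSpaceMeasure μ] g) (s : ℝ) (x : X) :
    lusin μ q (volOp μ s f) x = lusin μ q (volOp μ s g) x := by
  unfold lusin
  congr 1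
  refine lintegral_congr_ae (ae_restrict_of_ae ?_)
  filter_upwards [h] with z hz
  simp [volOp, hz]

omit [BorelSpace X] in
theorem boxNorm_mono (hq : 0 < q) {f g : X × ℝ → ℂ} (h : ∀ z, ‖f z‖ₑ ≤ ‖g z‖ₑ) (i : ι) :
    boxNorm μ n q k ctr l a f i ≤ boxNorm μ n q k ctr l a g i := by
  unfold boxNorm
  gcongr
  exact h _

omit [BorelSpace X] in
theorem boxNorm_add_le (hq : 1 ≤ q) (f g : L0 μ) (i : ι) :
    boxNorm μ n q k ctr l a (f + g : L0 μ) i ≤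
      boxNorm μ n q k ctr l a f i + boxNorm μ n q k ctr l a g i := by
  have hq0 : 0 ≤ 1 / q := by positivity
  unfold boxNorm
  rw [ENNReal.mul_rpow_of_nonneg _ _ hq0, ENNReal.mul_rpow_of_nonneg _ _ hq0,
    ENNReal.mul_rpow_of_nonneg _ _ hq0, ← mul_add]
  gcongr
  refine le_trans ?_ (ENNReal.lintegral_Lp_add_le f.stronglyMeasurable.measurable.enorm.aemeasurable
    g.stronglyMeasurable.measurable.enorm.aemeasurable hq)
  refine ENNReal.rpow_le_rpow (lintegral_mono_ae (ae_restrict_of_ae ?_)) hq0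
  filter_upwards [AEEqFun.coeFn_add f g] with z hz
  rw [hz]
  exact ENNReal.rpow_le_rpow (enorm_add_le _ _) (by linarith)

omit [BorelSpace X] in
theorem tentNorm_rpow (hp : 0 < p) (f : L0 μ) :
    tentNorm μ p q s f ^ p = ∫⁻ x, lusin μ q (volOp μ (-s) f) x ^ p ∂μ := by
  rw [tentNorm, ← ENNReal.rpow_mul, one_div_mul_cancel hp.ne', ENNReal.rpow_one]

/-- The powers of b add up to p and the scale exponents combine linearly; this is how p_θ and s_θ
appear. -/
theorem PowerParams.rpow_mul_rpow (h : PowerParams p₀ p₁ θ p η) (x y : ℝ) (b : ℝ≥0∞) :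
    ((eexp x * b) ^ p₀) ^ (1 - η) * ((eexp y * b) ^ p₁) ^ η =
      (eexp ((1 - θ) * x + θ * y) * b) ^ p := by
  have hp : 0 < p := by linarith [h.one_lt_p]
  have h1 : 0 ≤ (1 - θ) * p := mul_nonneg (by linarith [h.θ_lt]) hp.le
  have h2 : 0 ≤ θ * p := mul_nonneg h.θ_pos.le hp.le
  rw [← ENNReal.rpow_mul, ← ENNReal.rpow_mul, h.mul_one_sub, h.mul_eq,
    ENNReal.mul_rpow_of_nonneg _ _ h1, ENNReal.mul_rpow_of_nonneg _ _ h2,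
    ENNReal.mul_rpow_of_nonneg _ _ hp.le, mul_mul_mul_comm, eexp_rpow, eexp_rpow, eexp_rpow,
    ← eexp_add, ← ENNReal.rpow_add_of_nonneg _ _ h1 h2]
  congr 2 <;> ring

namespace IsRegular

/-- `tsum_split_le` is applied at each x to the boxes near x. Integrating in x then turns each box
into the volume of an enlarged ball, about e^{nlk}. -/
theorem tsum_lintegral_split_le (h : IsRegular μ n c) [Countable ι] (hg : IsGrid k ctr l a)
    (hp₀ : 0 < p₀) (hp₁ : 0 < p₁) {c₀ c₁ : ℝ} (hc : c₀ ≠ c₁) (hη0 : 0 < η) (hη1 : η < 1) (v : ℝ) :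
    ∃ C : ℝ≥0∞, C ≠ ∞ ∧ ∀ β : ι → ℝ≥0∞, (∀ i, β i ≠ ∞) →
      ∑' m : ℤ, eexp (-η * m) * ∫⁻ x, (∑' i, ({i | dist (ctr i) x < Real.exp (l * k i + v)} ∩
        {i | (eexp (c₀ * k i) * β i) ^ p₀ ≤ eexp m * (eexp (c₁ * k i) * β i) ^ p₁}).indicator
          (fun i => eexp (c₀ * k i) * β i) i) ^ p₀ ∂μ ≤
      C * ∑' i, eexp (n * l * k i) * (((eexp (c₀ * k i) * β i) ^ p₀) ^ (1 - η) *
        ((eexp (c₁ * k i) * β i) ^ p₁) ^ η) := by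
  obtain ⟨N, hN, hcount⟩ := hg.count v
  obtain ⟨C, hC, hsplit⟩ := tsum_split_le k hp₀ hp₁ hc hη0 hη1 hN
  refine ⟨C * eexp (n * v + c), ENNReal.mul_ne_top hC (eexp_ne_top _), fun β hβ => ?_⟩
  have hind (x : X) (J : Set ι) (g : ι → ℝ≥0∞) (i : ι) :
      ({i | dist (ctr i) x < Real.exp (l * k i + v)} ∩ J).indicator g i =
        (Metric.ball (ctr i) (Real.exp (l * k i + v))).indicator (fun _ => J.indicator g i) x := by
    by_cases h1 : dist x (ctr i) < Real.exp (l * k i + v)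
    · by_cases h2 : i ∈ J <;> simp [indicator, h1, h2, dist_comm (ctr i)]
    · simp [indicator, h1, dist_comm (ctr i)]
  have hmeas (J : Set ι) (g : ι → ℝ≥0∞) : Measurable fun x => ∑' i,
      ({i | dist (ctr i) x < Real.exp (l * k i + v)} ∩ J).indicator g i := by
    simp only [hind]
    exact Measurable.tsum fun i =>
      measurable_const.indicator Metric.isOpen_ball.measurableSet
  set G : ι → ℝ≥0∞ := fun i => ((eexp (c₀ * k i) * β i) ^ p₀) ^ (1 - η) *
        ((eexp (c₁ * k i) * β i) ^ p₁) ^ η with hG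
  calc _ = ∫⁻ x, ∑' m : ℤ, eexp (-η * m) *
        (∑' i, ({i | dist (ctr i) x < Real.exp (l * k i + v)} ∩
        {i | (eexp (c₀ * k i) * β i) ^ p₀ ≤ eexp m * (eexp (c₁ * k i) * β i) ^ p₁}).indicator
          (fun i => eexp (c₀ * k i) * β i) i) ^ p₀ ∂μ := by
        rw [lintegral_tsum fun m => (((hmeas _ _).pow_const _).const_mul _).aemeasurable]
        refine tsum_congr fun m => ?_
        rw [lintegral_const_mul' _ _ (eexp_ne_top _)]
    _ ≤ ∫⁻ x, C * ∑' i, (Metric.ball (ctr i) (Real.exp (l * k i + v))).indicator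
          (fun _ => G i) x ∂μ := by
        refine lintegral_mono fun x => (hsplit β _ hβ (hcount x)).trans (le_of_eq ?_)
        congr 1
        refine tsum_congr fun i => ?_
        rw [← inter_univ {i | dist (ctr i) x < Real.exp (l * k i + v)}, hind, indicator_univ]
    _ = C * ∑' i, G i * μ (Metric.ball (ctr i) (Real.exp (l * k i + v))) := by
        rw [lintegral_const_mul' _ _ hC, lintegral_tsum fun i =>
          (measurable_const.indicator Metric.isOpen_ball.measurableSet).aemeasurable]
        congr 1
        exact tsum_congr fun i => lintegral_indicator_const Metric.isOpen_ball.measurableSet _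
    _ ≤ C * ∑' i, G i * eexp (n * (l * k i + v) + c) := by
        gcongr with i
        exact h.ball_le _ _
    _ = _ := by
        rw [mul_assoc, ← ENNReal.tsum_mul_left (a := eexp (n * v + c))]
        congr 1
        refine tsum_congr fun i => ?_
        rw [show n * (l * k i + v) + c = n * v + c + n * l * k i by ring, eexp_add]
        ring

/-- The tent norm of the restriction of `f` to a union of boxes. -/
theorem tentNorm_rpow_le (h : IsRegular μ n c) [Countable ι] (hl : 0 < l) (hp : 0 < p) (hq : 1 ≤ q)
    (s : ℝ) {v : ℝ} (hv : Real.exp (-a) + Real.exp l ≤ Real.exp v) :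
    ∃ C : ℝ≥0∞, C ≠ ∞ ∧ ∀ (f g : L0 μ) (S : Set (X × ℝ)) (J : Set ι),
      g =ᵐ[halfSpaceMeasure μ] S.indicator f →
      (∀ z ∈ S, 0 < z.2 → ∃ i ∈ J, z ∈ box k ctr l a i) →
      tentNorm μ p q s g ^ p ≤
        C * ∫⁻ x, (∑' i, ({i | dist (ctr i) x < Real.exp (l * k i + v)} ∩ J).indicator
          (fun i => eexp (-s * n * l * k i) * boxNorm μ n q k ctr l a f i) i) ^ p ∂μ := by
  refine ⟨eexp (|(-s)| * (n * l + c) + c / q) ^ p,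
    ENNReal.rpow_ne_top_of_nonneg hp.le (eexp_ne_top _), fun f g S J hgS hS => ?_⟩
  rw [tentNorm_rpow hp, ← lintegral_const_mul' _ _
    (ENNReal.rpow_ne_top_of_nonneg hp.le (eexp_ne_top _))]
  refine lintegral_mono fun x => ?_
  rw [← ENNReal.mul_rpow_of_nonneg _ _ hp.le, lusin_congr_ae hgS]
  refine ENNReal.rpow_le_rpow ?_ hp.le
  refine (h.lusin_le (k := k) (ctr := ctr) hl hq (-s) hv _ J (fun z hz hne => ?_) x).trans ?_
  · refine hS z ?_ hz
    by_contra hzS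
    exact hne (indicator_of_notMem hzS _)
  · gcongr _ * ?_
    refine ENNReal.tsum_le_tsum fun i => indicator_le_indicator ?_
    gcongr
    refine boxNorm_mono (by linarith) (fun z => ?_) i
    by_cases hz : z ∈ S <;> simp [hz]

/-- The real interpolation norm is controlled by the discrete norm. -/
theorem realInterpNorm_le_tsum_boxNorm (h : IsRegular μ n c) [Countable ι] (hg : IsGrid k ctr l a)
    (hl : 0 < l) (hP : PowerParams p₀ p₁ θ p η) (hq : 1 ≤ q) {s₀ s₁ : ℝ} (hs : s₀ ≠ s₁) :
    ∃ C : ℝ≥0∞, C ≠ ∞ ∧ ∀ f : L0 μ,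
      realInterpNorm (tentNorm μ p₀ q s₀) (tentNorm μ p₁ q s₁) θ p f ^ p ≤
        C * ∑' i, eexp (n * l * k i) * (eexp (-((1 - θ) * s₀ + θ * s₁) * n * l * k i) *
          boxNorm μ n q k ctr l a f i) ^ p := by
  have hp : 0 < p := by linarith [hP.one_lt_p]
  have hp₀ : 0 < p₀ := by linarith [hP.one_lt_p₀]
  have hp₁ : 0 < p₁ := by linarith [hP.one_lt_p₁]
  have hnl : 0 < n * l := mul_pos h.n_pos hl
  have hc : -s₀ * n * l ≠ -s₁ * n * l := by
    intro he
    apply hs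
    rw [mul_assoc, mul_assoc] at he
    exact neg_injective (mul_right_cancel₀ hnl.ne' he)
  set v := Real.log (Real.exp (-a) + Real.exp l) with hv
  have hve : Real.exp (-a) + Real.exp l ≤ Real.exp v := (Real.exp_log (by positivity)).ge
  obtain ⟨C, hC, hint⟩ := realInterpNorm_rpow_le_of_decomp (A := L0 μ) hP
  obtain ⟨C₀, hC₀, hT₀⟩ := h.tentNorm_rpow_le (k := k) (ctr := ctr) hl hp₀ hq s₀ hve
  obtain ⟨C₁, hC₁, hT₁⟩ := h.tentNorm_rpow_le (k := k) (ctr := ctr) hl hp₁ hq s₁ hve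
  obtain ⟨D₀, hD₀, hS₀⟩ := h.tsum_lintegral_split_le hg hp₀ hp₁ hc hP.η_pos hP.η_lt v
  obtain ⟨D₁, hD₁, hS₁⟩ := h.tsum_lintegral_split_le hg hp₁ hp₀ hc.symm
    (sub_pos.2 hP.η_lt) (sub_lt_self 1 hP.η_pos) v
  refine ⟨C * (C₀ * D₀ + C₁ * D₁) + 1, by simp [ENNReal.mul_eq_top, *], fun f => ?_⟩
  set β : ι → ℝ≥0∞ := boxNorm μ n q k ctr l a f with hβ
  set A : ι → ℝ≥0∞ := fun i => (eexp (-s₀ * n * l * k i) * β i) ^ p₀ with hA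
  set B : ι → ℝ≥0∞ := fun i => (eexp (-s₁ * n * l * k i) * β i) ^ p₁ with hB
  set D := ∑' i, eexp (n * l * k i) *
    (eexp (-((1 - θ) * s₀ + θ * s₁) * n * l * k i) * β i) ^ p with hD
  rcases eq_or_ne D ∞ with hDt | hDt
  · rw [hDt, ENNReal.mul_top (by simp)]; exact le_top
  have hβt (i : ι) : β i ≠ ∞ := by
    intro ht
    refine hDt (top_le_iff.1 (le_trans ?_ (ENNReal.le_tsum i)))
    simp [ht, hp]
  have hAB : ∑' i, eexp (n * l * k i) * (A i ^ (1 - η) * B i ^ η) = D := by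
    refine tsum_congr fun i => ?_
    rw [hA, hB, hP.rpow_mul_rpow]
    congr 4; ring
  -- Boxes overlap, so f is cut along the set `T m` they cover rather than box by box. A point off
  -- `T m` lies only in boxes outside `J m`, which is what the second piece needs.
  set J : ℤ → Set ι := fun m => {i | A i ≤ eexp m * B i} with hJ
  set T : ℤ → Set (X × ℝ) := fun m => ⋃ i ∈ J m, box k ctr l a i with hTdef
  have hTm (m : ℤ) : MeasurableSet (T m) :=
    MeasurableSet.biUnion (to_countable _) fun i _ => measurableSet_box i
  have hfm := f.aestronglyMeasurable
  set f₀ : ℤ → L0 μ := fun m => AEEqFun.mk ((T m).indicator f) (hfm.indicator (hTm m)) with hf₀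
  set f₁ : ℤ → L0 μ := fun m => AEEqFun.mk ((T m)ᶜ.indicator f) (hfm.indicator (hTm m).compl)
    with hf₁
  have hsum (m : ℤ) : f₀ m + f₁ m = f := by
    rw [hf₀, hf₁, AEEqFun.mk_add_mk]
    conv_rhs => rw [← AEEqFun.mk_coeFn f]
    congr 1
    exact indicator_self_add_compl _ _
  have hb₀ : ∑' m : ℤ, eexp (-η * m) * tentNorm μ p₀ q s₀ (f₀ m) ^ p₀ ≤ C₀ * D₀ * D := by
    calc _ ≤ ∑' m : ℤ, eexp (-η * m) * (C₀ * ∫⁻ x, (∑' i,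
          ({i | dist (ctr i) x < Real.exp (l * k i + v)} ∩ J m).indicator
            (fun i => eexp (-s₀ * n * l * k i) * β i) i) ^ p₀ ∂μ) := by
          gcongr with m
          refine hT₀ f (f₀ m) (T m) (J m) (AEEqFun.coeFn_mk _ _) fun z hz _ => ?_
          obtain ⟨i, hi, hzi⟩ := mem_iUnion₂.1 hz
          exact ⟨i, hi, hzi⟩
      _ = C₀ * ∑' m : ℤ, eexp (-η * m) * ∫⁻ x, (∑' i,
          ({i | dist (ctr i) x < Real.exp (l * k i + v)} ∩ J m).indicator
            (fun i => eexp (-s₀ * n * l * k i) * β i) i) ^ p₀ ∂μ := by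
          rw [← ENNReal.tsum_mul_left]
          exact tsum_congr fun m => by ring
      _ ≤ C₀ * (D₀ * D) := by
          gcongr
          rw [← hAB]
          exact hS₀ β hβt
      _ = _ := by ring
  have hb₁ : ∑' m : ℤ, eexp ((1 - η) * m) * tentNorm μ p₁ q s₁ (f₁ m) ^ p₁ ≤ C₁ * D₁ * D := by
    -- Reflecting m turns the second piece into the first with the indices 0 and 1 exchanged and 1 -
    -- η in place of η.
    rw [← (Equiv.neg ℤ).tsum_eq]
    calc _ ≤ ∑' m : ℤ, eexp (-(1 - η) * m) * (C₁ * ∫⁻ x, (∑' i,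
          ({i | dist (ctr i) x < Real.exp (l * k i + v)} ∩ {i | B i ≤ eexp m * A i}).indicator
            (fun i => eexp (-s₁ * n * l * k i) * β i) i) ^ p₁ ∂μ) := by
          refine ENNReal.tsum_le_tsum fun m => ?_
          rw [Equiv.neg_apply, Int.cast_neg, mul_neg, ← neg_mul]
          gcongr
          refine hT₁ f (f₁ (-m)) (T (-m))ᶜ {i | B i ≤ eexp m * A i} (AEEqFun.coeFn_mk _ _)
            fun z hz hz0 => ?_
          obtain ⟨i, hi⟩ := hg.exists_mem_box hl hz0
          refine ⟨i, ?_, hi⟩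
          have hiJ : ¬ A i ≤ eexp (-m : ℤ) * B i := fun hle => hz (mem_biUnion hle hi)
          push Not at hiJ
          calc B i = eexp m * (eexp (-m : ℤ) * B i) := by
                rw [← mul_assoc, Int.cast_neg, eexp_mul_neg_cancel, one_mul]
            _ ≤ _ := by gcongr
      _ = C₁ * ∑' m : ℤ, eexp (-(1 - η) * m) * ∫⁻ x, (∑' i,
          ({i | dist (ctr i) x < Real.exp (l * k i + v)} ∩ {i | B i ≤ eexp m * A i}).indicator
            (fun i => eexp (-s₁ * n * l * k i) * β i) i) ^ p₁ ∂μ := by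
          rw [← ENNReal.tsum_mul_left]
          exact tsum_congr fun m => by ring
      _ ≤ C₁ * (D₁ * D) := by
          gcongr
          refine (hS₁ β hβt).trans (le_of_eq ?_)
          rw [← hAB, sub_sub_cancel]
          congr 1
          exact tsum_congr fun i => by rw [mul_comm ((_ ^ p₁) ^ η)]
      _ = _ := by ring
  calc _ ≤ C * (C₀ * D₀ * D + C₁ * D₁ * D) :=
        (hint _ _ f f₀ f₁ hsum).trans (by gcongr)
    _ = C * (C₀ * D₀ + C₁ * D₁) * D := by ring
    _ ≤ _ := by gcongr; exact le_self_add

/-- The discrete norm is controlled by the real interpolation norm. -/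
theorem tsum_boxNorm_le_realInterpNorm (h : IsRegular μ n c) [Countable ι]
    (hg : IsGrid k ctr l a) (hl : 0 < l) (ha : 2 * Real.exp (-a) ≤ 1)
    (hP : PowerParams p₀ p₁ θ p η) (hq : 1 ≤ q) {s₀ s₁ : ℝ} (hs : s₀ ≠ s₁) :
    ∃ C : ℝ≥0∞, C ≠ ∞ ∧ ∀ f : L0 μ,
      ∑' i, eexp (n * l * k i) * (eexp (-((1 - θ) * s₀ + θ * s₁) * n * l * k i) *
          boxNorm μ n q k ctr l a f i) ^ p ≤
        C * realInterpNorm (tentNorm μ p₀ q s₀) (tentNorm μ p₁ q s₁) θ p f ^ p := by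
  have hp : 0 < p := by linarith [hP.one_lt_p]
  have hp₀ : 0 < p₀ := by linarith [hP.one_lt_p₀]
  have hp₁ : 0 < p₁ := by linarith [hP.one_lt_p₁]
  have hq0 : 0 < q := by linarith
  have hnl : 0 < n * l := mul_pos h.n_pos hl
  have hc : -s₀ * n * l ≠ -s₁ * n * l := by
    intro he
    apply hs
    rw [mul_assoc, mul_assoc] at he
    exact neg_injective (mul_right_cancel₀ hnl.ne' he)
  obtain ⟨N, hN, hcount⟩ := hg.count (-a)
  obtain ⟨C, hC, hsup⟩ := tsum_le_tsum_iSup_min k hP.one_lt_p₀.le hp₁ hc hP.η_pos hP.η_lt hN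
  obtain ⟨D, hD, hL⟩ := tsum_lFunctional_le (A := L0 μ) hP
  set I : X → Set ι := fun x => {i | x ∈ Metric.ball (ctr i) (Real.exp (l * k i - a))} with hI
  set e : ℝ → ℝ≥0∞ := fun s => eexp (|(-s)| * (n * l + c) + (n * l + c) / q) with he
  have hsupm (w : ι → ℝ≥0∞) : Measurable fun x => ⨆ i ∈ I x, w i := by
    have (x : X) : ⨆ i ∈ I x, w i = ⨆ i,
        (Metric.ball (ctr i) (Real.exp (l * k i - a))).indicator (fun _ => w i) x := by
      refine iSup_congr fun i => ?_
      by_cases hx : x ∈ Metric.ball (ctr i) (Real.exp (l * k i - a))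
      · rw [indicator_of_mem hx]
        exact iSup_pos (p := i ∈ I x) hx
      · rw [indicator_of_notMem hx]
        exact iSup_neg (p := i ∈ I x) hx
    simp only [this]
    exact Measurable.iSup fun i => measurable_const.indicator Metric.isOpen_ball.measurableSet
  have htent (r s : ℝ) (hr : 0 < r) (g : L0 μ) :
      ∫⁻ x, ⨆ i ∈ I x, (eexp (-s * n * l * k i) * boxNorm μ n q k ctr l a g i) ^ r ∂μ ≤
        e s ^ r * tentNorm μ r q s g ^ r := by
    rw [tentNorm_rpow hr, ← lintegral_const_mul' _ _
      (ENNReal.rpow_ne_top_of_nonneg hr.le (eexp_ne_top _))]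
    refine lintegral_mono fun x => iSup₂_le fun i hi => ?_
    rw [← ENNReal.mul_rpow_of_nonneg _ _ hr.le]
    exact ENNReal.rpow_le_rpow (h.le_lusin hl hq0 (-s) ha g hi) hr.le
  have hfin (r s : ℝ) (hr : 0 < r) (g : L0 μ) (hgt : tentNorm μ r q s g ^ r ≠ ∞) (i : ι) :
      boxNorm μ n q k ctr l a g i ≠ ∞ := by
    intro ht
    -- An infinite box norm makes the Lusin function infinite on the base, which has positive
    -- measure.
    have h1 : ∫⁻ x in Metric.ball (ctr i) (Real.exp (l * k i - a)), ∞ ∂μ ≤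
        e s ^ r * tentNorm μ r q s g ^ r := by
      refine le_trans ?_ (htent r s hr g)
      refine (setLIntegral_mono' Metric.isOpen_ball.measurableSet fun x hx => ?_).trans
        (setLIntegral_le_lintegral _ _)
      refine le_iSup₂_of_le i hx ?_
      simp [ht, hr]
    have h2 := h.le_ball (ctr i) (l * k i - a)
    rw [setLIntegral_const, ENNReal.top_mul (fun h0 => by simp [h0] at h2)] at h1
    exact ENNReal.mul_ne_top (ENNReal.rpow_ne_top_of_nonneg hr.le (eexp_ne_top _)) hgt
      (top_le_iff.1 h1)
  set E := 2 ^ p₀ * e s₀ ^ p₀ + 2 ^ p₁ * e s₁ ^ p₁ with hE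
  have hEt : E ≠ ∞ := by
    refine ENNReal.add_ne_top.2 ⟨ENNReal.mul_ne_top ?_ ?_, ENNReal.mul_ne_top ?_ ?_⟩
    · exact ENNReal.rpow_ne_top_of_nonneg hp₀.le (by simp)
    · exact ENNReal.rpow_ne_top_of_nonneg hp₀.le (eexp_ne_top _)
    · exact ENNReal.rpow_ne_top_of_nonneg hp₁.le (by simp)
    · exact ENNReal.rpow_ne_top_of_nonneg hp₁.le (eexp_ne_top _)
  -- A nonzero finite constant may be moved inside the infimum defining L.
  have hE0 : E ≠ 0 := by
    simp [hE, he, ENNReal.rpow_eq_zero_iff, hp₀.not_gt]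
  have hlow (f : L0 μ) (m : ℤ) : ∫⁻ x, ⨆ i ∈ I x,
      min ((eexp (-s₀ * n * l * k i) * boxNorm μ n q k ctr l a f i) ^ p₀)
        (eexp m * (eexp (-s₁ * n * l * k i) * boxNorm μ n q k ctr l a f i) ^ p₁) ∂μ ≤
      E * lFunctional (tentNorm μ p₀ q s₀) (tentNorm μ p₁ q s₁) p₀ p₁ m f := by
    simp only [lFunctional, ENNReal.mul_iInf_of_ne hE0 hEt]
    refine le_iInf fun g => le_iInf fun g' => le_iInf fun hgg => ?_
    set b := boxNorm μ n q k ctr l a g with hb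
    set b' := boxNorm μ n q k ctr l a g' with hb'
    -- Whichever piece has the larger box norm carries at least half of that of f, and the
    -- corresponding entry of the minimum is chosen.
    have hpt (i : ι) : min ((eexp (-s₀ * n * l * k i) * boxNorm μ n q k ctr l a f i) ^ p₀)
        (eexp m * (eexp (-s₁ * n * l * k i) * boxNorm μ n q k ctr l a f i) ^ p₁) ≤
        2 ^ p₀ * (eexp (-s₀ * n * l * k i) * b i) ^ p₀ +
          eexp m * (2 ^ p₁ * (eexp (-s₁ * n * l * k i) * b' i) ^ p₁) := by
      have hadd : boxNorm μ n q k ctr l a f i ≤ b i + b' i := by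
        rw [← hgg]; exact boxNorm_add_le hq g g' i
      rw [← ENNReal.mul_rpow_of_nonneg _ _ hp₀.le, ← ENNReal.mul_rpow_of_nonneg _ _ hp₁.le,
        mul_left_comm, mul_left_comm 2, two_mul, two_mul]
      rcases le_total (b i) (b' i) with hle | hle
      · refine (min_le_right _ _).trans (le_add_left ?_)
        gcongr
        exact hadd.trans (by gcongr)
      · refine (min_le_left _ _).trans (le_add_right ?_)
        gcongr
        exact hadd.trans (by gcongr)
    calc _ ≤ ∫⁻ x, 2 ^ p₀ * (⨆ i ∈ I x, (eexp (-s₀ * n * l * k i) * b i) ^ p₀) +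
          eexp m * (2 ^ p₁ * ⨆ i ∈ I x, (eexp (-s₁ * n * l * k i) * b' i) ^ p₁) ∂μ := by
          refine lintegral_mono fun x => iSup₂_le fun i hi => (hpt i).trans ?_
          gcongr
          · exact le_iSup₂_of_le (f := fun i _ => (eexp (-s₀ * n * l * k i) * b i) ^ p₀) i hi le_rfl
          · exact le_iSup₂_of_le (f := fun i _ => (eexp (-s₁ * n * l * k i) * b' i) ^ p₁) i hi
              le_rfl
      _ = 2 ^ p₀ * (∫⁻ x, ⨆ i ∈ I x, (eexp (-s₀ * n * l * k i) * b i) ^ p₀ ∂μ) +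
          eexp m * (2 ^ p₁ * ∫⁻ x, ⨆ i ∈ I x, (eexp (-s₁ * n * l * k i) * b' i) ^ p₁ ∂μ) := by
          rw [lintegral_add_left ((hsupm _).const_mul _), lintegral_const_mul _ (hsupm _),
            lintegral_const_mul _ ((hsupm _).const_mul _), lintegral_const_mul _ (hsupm _)]
      _ ≤ 2 ^ p₀ * (e s₀ ^ p₀ * tentNorm μ p₀ q s₀ g ^ p₀) +
          eexp m * (2 ^ p₁ * (e s₁ ^ p₁ * tentNorm μ p₁ q s₁ g' ^ p₁)) := by
          gcongr
          · exact htent p₀ s₀ hp₀ g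
          · exact htent p₁ s₁ hp₁ g'
      _ = 2 ^ p₀ * e s₀ ^ p₀ * tentNorm μ p₀ q s₀ g ^ p₀ +
          2 ^ p₁ * e s₁ ^ p₁ * (eexp m * tentNorm μ p₁ q s₁ g' ^ p₁) := by ring
      _ ≤ E * tentNorm μ p₀ q s₀ g ^ p₀ + E * (eexp m * tentNorm μ p₁ q s₁ g' ^ p₁) := by
          gcongr
          · exact le_self_add
          · exact le_add_self
      _ = _ := by rw [mul_add]
  refine ⟨eexp (n * a + c) * C * E * D + 1, by simp [ENNReal.mul_eq_top, *], fun f => ?_⟩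
  set R := realInterpNorm (tentNorm μ p₀ q s₀) (tentNorm μ p₁ q s₁) θ p f ^ p with hR
  rcases eq_or_ne R ∞ with hRt | hRt
  · rw [hRt, ENNReal.mul_top (by simp)]; exact le_top
  set β : ι → ℝ≥0∞ := boxNorm μ n q k ctr l a f with hβ
  -- L is finite at m = 0, so f splits into two pieces of finite tent norm, each with finite box
  -- norms.
  have hβt (i : ι) : β i ≠ ∞ := by
    have h1 : lFunctional (tentNorm μ p₀ q s₀) (tentNorm μ p₁ q s₁) p₀ p₁ (0 : ℤ) f < ∞ := by
      refine lt_of_le_of_lt ?_ (ENNReal.mul_lt_top hD.lt_top hRt.lt_top)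
      refine le_trans ?_ ((ENNReal.le_tsum 0).trans (hL _ _ f))
      simp
    simp only [lFunctional, iInf_lt_iff] at h1
    obtain ⟨g, g', hgg, hlt⟩ := h1
    rw [Int.cast_zero, eexp_zero, one_mul, ENNReal.add_lt_top] at hlt
    refine ne_top_of_le_ne_top (ENNReal.add_ne_top.2 ⟨hfin p₀ s₀ hp₀ g hlt.1.ne i,
      hfin p₁ s₁ hp₁ g' hlt.2.ne i⟩) ?_
    rw [hβ, ← hgg]
    exact boxNorm_add_le hq g g' i
  set G : ι → ℝ≥0∞ := fun i => ((eexp (-s₀ * n * l * k i) * β i) ^ p₀) ^ (1 - η) *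
        ((eexp (-s₁ * n * l * k i) * β i) ^ p₁) ^ η with hG
  calc _ = ∑' i, eexp (n * l * k i) * G i := by
        refine tsum_congr fun i => ?_
        rw [hG]
        simp only [hP.rpow_mul_rpow]
        congr 4; ring
    _ ≤ ∑' i, eexp (n * a + c) *
          (G i * μ (Metric.ball (ctr i) (Real.exp (l * k i - a)))) := by
        refine ENNReal.tsum_le_tsum fun i => ?_
        calc _ = eexp (n * a + c) * (G i * eexp (n * (l * k i - a) - c)) := by
              rw [mul_left_comm _ (G i), ← eexp_add, mul_comm _ (G i)]
              congr 2; ring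
          _ ≤ _ := by gcongr; exact h.le_ball _ _
    _ = eexp (n * a + c) * ∫⁻ x, ∑' i, (I x).indicator G i ∂μ := by
        rw [ENNReal.tsum_mul_left]
        congr 1
        have (x : X) (i : ι) : (I x).indicator G i =
            (Metric.ball (ctr i) (Real.exp (l * k i - a))).indicator (fun _ => G i) x := rfl
        simp only [this]
        rw [lintegral_tsum fun i =>
          (measurable_const.indicator Metric.isOpen_ball.measurableSet).aemeasurable]
        exact tsum_congr fun i =>
          (lintegral_indicator_const Metric.isOpen_ball.measurableSet _).symm
    _ ≤ eexp (n * a + c) * ∫⁻ x, C * ∑' m : ℤ, eexp (-η * m) * ⨆ i ∈ I x,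
          min ((eexp (-s₀ * n * l * k i) * β i) ^ p₀)
            (eexp m * (eexp (-s₁ * n * l * k i) * β i) ^ p₁) ∂μ := by
        gcongr _ * ?_
        refine lintegral_mono fun x => hsup β (I x) hβt ?_
        refine level_mono (fun i (hi : dist x (ctr i) < _) => ?_) (hcount x)
        change dist (ctr i) x < _
        rwa [dist_comm, ← sub_eq_add_neg]
    _ = eexp (n * a + c) * (C * ∑' m : ℤ, eexp (-η * m) * ∫⁻ x, ⨆ i ∈ I x,
          min ((eexp (-s₀ * n * l * k i) * β i) ^ p₀)
            (eexp m * (eexp (-s₁ * n * l * k i) * β i) ^ p₁) ∂μ) := by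
        rw [lintegral_const_mul' _ _ hC,
          lintegral_tsum fun m => ((hsupm _).const_mul _).aemeasurable]
        congr 2
        exact tsum_congr fun m => lintegral_const_mul' _ _ (eexp_ne_top _)
    _ ≤ eexp (n * a + c) * (C * ∑' m : ℤ, eexp (-η * m) *
          (E * lFunctional (tentNorm μ p₀ q s₀) (tentNorm μ p₁ q s₁) p₀ p₁ m f)) := by
        gcongr with m
        exact hlow f m
    _ = eexp (n * a + c) * C * E * ∑' m : ℤ, eexp (-η * m) *
          lFunctional (tentNorm μ p₀ q s₀) (tentNorm μ p₁ q s₁) p₀ p₁ m f := by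
        simp only [mul_left_comm _ E, ENNReal.tsum_mul_left]
        ring
    _ ≤ eexp (n * a + c) * C * E * (D * R) := by
        gcongr; exact hL _ _ f
    _ ≤ _ := by rw [← mul_assoc]; gcongr; exact le_self_add

end IsRegular

omit [BorelSpace X] in
theorem zNorm_rpow (hp : 0 < p) (c₀ c₁ : ℝ) (f : L0 μ) : zNorm μ p q s c₀ c₁ f ^ p =
    ∫⁻ z, whitneyAverage μ q c₀ c₁ (volOp μ (-s) f) z ^ p ∂(halfSpaceMeasure μ) := by
  rw [zNorm, ← ENNReal.rpow_mul, one_div_mul_cancel hp.ne', ENNReal.rpow_one]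

theorem le_of_rpow_le_mul_rpow (hp : 0 < p) {C : ℝ≥0∞} (hC : C ≠ ∞) {x y : ℝ≥0∞}
    (h : x ^ p ≤ C * y ^ p) : x ≤ ((C ^ (1 / p)).toNNReal : ℝ≥0∞) * y := by
  rw [ENNReal.coe_toNNReal (ENNReal.rpow_ne_top_of_nonneg (by positivity) hC),
    ← ENNReal.rpow_le_rpow_iff hp, ENNReal.mul_rpow_of_nonneg _ _ hp.le, ← ENNReal.rpow_mul,
    one_div_mul_cancel hp.ne', ENNReal.rpow_one]
  exact h

theorem exists_powerParams (hp₀ : 1 < p₀) (hp₁ : 1 < p₁) (h0 : 0 < θ) (h1 : θ < 1)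
    (hp : p⁻¹ = (1 - θ) * p₀⁻¹ + θ * p₁⁻¹) : ∃ η, PowerParams p₀ p₁ θ p η := by
  have hp₀' : 0 < p₀ := by linarith
  have hp₁' : 0 < p₁ := by linarith
  have hθ : 0 < 1 - θ := by linarith
  have hpi : 0 < p⁻¹ := by rw [hp]; positivity
  have hp0 : 0 < p := inv_pos.1 hpi
  have hp1 : 1 < p := by
    rw [← inv_lt_one_iff₀.trans (or_iff_right hp0.not_ge), hp]
    have := inv_lt_one_of_one_lt₀ hp₀
    have := inv_lt_one_of_one_lt₀ hp₁
    nlinarith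
  have hmul : 1 = (1 - θ) * p₀⁻¹ * p + θ * p₁⁻¹ * p := by
    rw [← add_mul, ← hp, inv_mul_cancel₀ hp0.ne']
  have hpos : 0 < (1 - θ) * p₀⁻¹ * p := by positivity
  -- η = θp/p₁ is forced by p₁η = θp, and the relation for 1/p then gives 1 - η = (1-θ)p/p₀.
  refine ⟨θ * p₁⁻¹ * p, hp₀, hp₁, hp1, h0, h1, by positivity, by linarith, ?_, by field_simp⟩
  rw [show 1 - θ * p₁⁻¹ * p = (1 - θ) * p₀⁻¹ * p by linarith]
  field_simp

/-- The real interpolation norm and the `Z`-norm are comparable. -/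
theorem exists_realInterpNorm_equiv_zNorm (hAD : IsADRegular μ)
    (hX : ¬ Bornology.IsBounded (univ : Set X)) {s₀ s₁ c₀ c₁ : ℝ}
    (hp₀ : 1 < p₀) (hp₁ : 1 < p₁) (hq : 1 < q) (hs : s₀ ≠ s₁) (h0 : 0 < θ) (h1 : θ < 1)
    (hp : p⁻¹ = (1 - θ) * p₀⁻¹ + θ * p₁⁻¹) (hc₀ : 0 < c₀) (hc₁ : 1 < c₁) :
    ∃ C : ℝ≥0, ∀ f : L0 μ,
      realInterpNorm (tentNorm μ p₀ q s₀) (tentNorm μ p₁ q s₁) θ p f ≤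
        C * zNorm μ p q ((1 - θ) * s₀ + θ * s₁) c₀ c₁ f ∧
      zNorm μ p q ((1 - θ) * s₀ + θ * s₁) c₀ c₁ f ≤
        C * realInterpNorm (tentNorm μ p₀ q s₀) (tentNorm μ p₁ q s₁) θ p f := by
  obtain ⟨η, hP⟩ := exists_powerParams hp₀ hp₁ h0 h1 hp
  have hp' : 0 < p := by linarith [hP.one_lt_p]
  obtain ⟨n, c, h⟩ := exists_isRegular hAD hX
  -- The grid is adapted to the aperture: layers have ratio c₁, and 2e^{-a} = min(c₀, 1) places each
  -- box inside the Whitney regions of its points and inside the cones over its base.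
  obtain ⟨l, rfl⟩ : ∃ l, c₁ = Real.exp l := ⟨Real.log c₁, (Real.exp_log (by linarith)).symm⟩
  have hl : 0 < l := Real.one_lt_exp_iff.1 hc₁
  have hmin : 0 < min c₀ 1 / 2 := by positivity
  set a := -Real.log (min c₀ 1 / 2) with ha
  have hexp : 2 * Real.exp (-a) = min c₀ 1 := by
    rw [ha, neg_neg, Real.exp_log hmin]; ring
  obtain ⟨S, hS, hg⟩ := h.exists_isGrid l a
  have (j : ℤ) : Countable (S j) := (hS j).to_subtype
  obtain ⟨C₁, hC₁, h₁⟩ := h.realInterpNorm_le_tsum_boxNorm hg hl hP hq.le hs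
  obtain ⟨C₂, hC₂, h₂⟩ := h.tsum_boxNorm_le_realInterpNorm hg hl
    (hexp.trans_le (min_le_right _ _)) hP hq.le hs
  obtain ⟨C₃, hC₃, h₃⟩ := h.tsum_boxNorm_le_lintegral_whitney (q := q) hg hl hp' (by linarith)
    (-((1 - θ) * s₀ + θ * s₁)) hc₀ (hexp.trans_le (min_le_left _ _))
  obtain ⟨C₄, hC₄, h₄⟩ := h.lintegral_whitney_le_tsum_boxNorm hg hl hp' hq.le
    (-((1 - θ) * s₀ + θ * s₁)) hc₀
  refine ⟨max ((C₁ * C₃) ^ (1 / p)).toNNReal ((C₄ * C₂) ^ (1 / p)).toNNReal, fun f => ⟨?_, ?_⟩⟩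
  · refine (le_of_rpow_le_mul_rpow hp' (ENNReal.mul_ne_top hC₁ hC₃) ?_).trans
      (mul_le_mul_left (ENNReal.coe_le_coe.2 (le_max_left _ _)) _)
    rw [zNorm_rpow hp', mul_assoc]
    exact (h₁ f).trans (by gcongr; exact h₃ f)
  · refine (le_of_rpow_le_mul_rpow hp' (ENNReal.mul_ne_top hC₄ hC₂) ?_).trans
      (mul_le_mul_left (ENNReal.coe_le_coe.2 (le_max_right _ _)) _)
    rw [zNorm_rpow hp', mul_assoc]
    exact (h₄ f).trans (by gcongr; exact h₂ f)

end Equivalence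

end WeightedTent

theorem theorem2 {X : Type*} [MetricSpace X] [MeasurableSpace X] [BorelSpace X]
    (μ : Measure X) (hAD : WeightedTent.IsADRegular μ)
    (hX : ¬ Bornology.IsBounded (univ : Set X)) :
    (∀ p₀ p₁ q s₀ s₁ θ pθ sθ c₀ c₁ : ℝ,
      1 < p₀ → 1 < p₁ → 1 < q → s₀ ≠ s₁ → 0 < θ → θ < 1 →
      pθ⁻¹ = (1 - θ) * p₀⁻¹ + θ * p₁⁻¹ → sθ = (1 - θ) * s₀ + θ * s₁ →
      0 < c₀ → 1 < c₁ →
        WeightedTent.RealInterpSpace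
            (WeightedTent.tentNorm μ p₀ q s₀) (WeightedTent.tentNorm μ p₁ q s₁) θ pθ
          = WeightedTent.ZSpace μ pθ q sθ c₀ c₁ ∧
        WeightedTent.EquivNormsOn (WeightedTent.ZSpace μ pθ q sθ c₀ c₁)
          (WeightedTent.realInterpNorm
            (WeightedTent.tentNorm μ p₀ q s₀) (WeightedTent.tentNorm μ p₁ q s₁) θ pθ)
          (WeightedTent.zNorm μ pθ q sθ c₀ c₁)) ∧
    (∀ p q s c₀ c₁ d₀ d₁ : ℝ,
      1 < p → 1 < q → 0 < c₀ → 1 < c₁ → 0 < d₀ → 1 < d₁ →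
        WeightedTent.ZSpace μ p q s c₀ c₁ = WeightedTent.ZSpace μ p q s d₀ d₁ ∧
        WeightedTent.EquivNormsOn (WeightedTent.ZSpace μ p q s c₀ c₁)
          (WeightedTent.zNorm μ p q s c₀ c₁) (WeightedTent.zNorm μ p q s d₀ d₁)) := by
  refine ⟨?_, ?_⟩
  · rintro p₀ p₁ q s₀ s₁ θ p _ c₀ c₁ hp₀ hp₁ hq hs h0 h1 hp rfl hc₀ hc₁
    obtain ⟨C, hC⟩ := WeightedTent.exists_realInterpNorm_equiv_zNorm hAD hX hp₀ hp₁ hq hs h0 h1 hp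
      hc₀ hc₁
    refine ⟨Set.ext fun f => ⟨fun hf => ?_, fun hf => ?_⟩, C, fun f _ => hC f⟩
    · exact (hC f).2.trans_lt (ENNReal.mul_lt_top ENNReal.coe_lt_top hf)
    · exact (hC f).1.trans_lt (ENNReal.mul_lt_top ENNReal.coe_lt_top hf)
  · intro p q s c₀ c₁ d₀ d₁ hp hq hc₀ hc₁ hd₀ hd₁
    -- Any `Z`-space is the midpoint of the couple with smoothness s - 1 and s + 1 and equal p,
    -- whose interpolation norm does not involve the aperture.
    have hs : s - 1 ≠ s + 1 := by intro h; linarith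
    have hpp : p⁻¹ = (1 - 1 / 2) * p⁻¹ + 1 / 2 * p⁻¹ := by ring
    have hss : (1 - 1 / 2) * (s - 1) + 1 / 2 * (s + 1) = s := by ring
    obtain ⟨C, hC⟩ := WeightedTent.exists_realInterpNorm_equiv_zNorm hAD hX hp hp hq hs
      one_half_pos one_half_lt_one hpp hc₀ hc₁
    obtain ⟨D, hD⟩ := WeightedTent.exists_realInterpNorm_equiv_zNorm hAD hX hp hp hq hs
      one_half_pos one_half_lt_one hpp hd₀ hd₁
    rw [hss] at hC hD
    have h1 (f : WeightedTent.L0 μ) : WeightedTent.zNorm μ p q s c₀ c₁ f ≤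
        ((C * D : ℝ≥0) : ℝ≥0∞) * WeightedTent.zNorm μ p q s d₀ d₁ f := by
      rw [ENNReal.coe_mul, mul_assoc]
      exact (hC f).2.trans (by gcongr; exact (hD f).1)
    have h2 (f : WeightedTent.L0 μ) : WeightedTent.zNorm μ p q s d₀ d₁ f ≤
        ((C * D : ℝ≥0) : ℝ≥0∞) * WeightedTent.zNorm μ p q s c₀ c₁ f := by
      rw [mul_comm C, ENNReal.coe_mul, mul_assoc]
      exact (hD f).2.trans (by gcongr; exact (hC f).1)
    refine ⟨Set.ext fun f => ⟨fun hf => ?_, fun hf => ?_⟩, C * D, fun f _ => ⟨h1 f, h2 f⟩⟩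
    · exact (h2 f).trans_lt (ENNReal.mul_lt_top ENNReal.coe_lt_top hf)
    · exact (h1 f).trans_lt (ENNReal.mul_lt_top ENNReal.coe_lt_top hf)
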